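/- Let $p$ be an odd prime, let $K$ be a field of characteristic $p$, and let $G=\langle g\rangle$ be a finite cyclic group whose order is divisible by $p$. Put $A=KG$. Let $C^n(A)=\mathrm{Hom}_K(A^{\otimes n},A)$ with the Hochschild differential, and let $HH^n(A)$ be its $n$-th cohomology. Let $HH^{odd}(A)=\bigoplus_{r\ge 0}HH^{2r+1}(A)$, with the Gerstenhaber bracket, that is, the bracket induced by $[f,h]=f\circ h-(-1)^{(n-1)(m-1)}h\circ f$ for $f\in C^n(A)$, $h\in C^m(A)$, where $$(f\circ h)(a_1,\dots,a_{n+m-1})=\sum_{i=1}^{n}(-1)^{(i-1)(m-1)}f(a_1,\dots,a_{i-1},h(a_i,\dots,a_{i+m-1}),a_{i+m},\dots,a_{n+m-1}).$$ This makes $HH^{odd}(A)$ a Lie algebra, with $HH^1(A)$ as a Lie subalgebra. A derivation of $A$ is identified with its class in $HH^1(A)$. For $n=2r+1$ let $\beta^n:G^n\to K$ be the map with $\beta^{n}(g^{i_1},\dots,g^{i_n})=i_1$ if $i_{k}+i_{k+1}\ge |G|$ for every even $k$ with $2\le k<n$, and $0$ otherwise, where $0\le i_1,\dots,i_n<|G|$.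 For $x\in G$ let $\beta^{n}\otimes x$ be the cochain in $C^{n}(A)$ with $(x_1,\dots,x_n)\mapsto\beta^{n}(x_1,\dots,x_n)\,x_1\cdots x_n\,x$ for $x_1,\dots,x_n\in G$. Then for each integer $i\ge 0$ there is a derivation $D_i$ of $A$ with $D_i(g)=g^{i+1}$; these satisfy $[D_i,D_j]=(j-i)D_{i+j}$ and span $HH^1(A)$. The cochains $\beta^{2r+1}\otimes g^i$ are cocycles, and there is an isomorphism of Lie algebras over $K$ $$HH^{odd}(A)\;\cong\; HH^1(A)\otimes_K K[t]$$ that sends the class of $\beta^{2r+1}\otimes g^i$ to $D_i\otimes t^r$ for all $r,i\ge 0$. Here $HH^1(A)\otimes_K K[t]$ is the current Lie algebra, with bracket $[D_i\otimes t^r,D_j\otimes t^s]=[D_i,D_j]\otimes t^{r+s}$. -/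

import Mathlib

open scoped TensorProduct Polynomial DirectSum

set_option linter.unusedSectionVars false

noncomputable section

namespace Hochschild

section Cochains

variable (K : Type*) (A : Type*) [CommRing K] [Ring A] [Algebra K A]

/-- Hochschild `n`-cochains: `K`-multilinear maps `A ^ n → A`, i.e. `Hom_K (A ^ ⊗ n, A)`. -/
abbrev Coch (n : ℕ) : Type _ := MultilinearMap K (fun _ : Fin n => A) A

variable {K A}

/-- A tuple `(x 0, …, x (N - 1))`, continued by zero to a sequence. -/
def seq {N : ℕ} (x : Fin N → A) : ℕ → A := fun k => if h : k < N then x ⟨k, h⟩ else 0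

/-- The value of a cochain on the first `n` terms of a sequence. -/
def Coch.ev {n : ℕ} (f : Coch K A n) (x : ℕ → A) : A := f fun j => x j

/-- `(x 0, …, x (i - 1), a, x (i + m), x (i + m + 1), …)`: the block of length `m` that starts at
position `i` is replaced by the single entry `a` (for `m = 0`, `a` is inserted before `x i`). -/
def ins (i m : ℕ) (a : A) (x : ℕ → A) : ℕ → A :=
  fun j => if j < i then x j else if j = i then a else x (j + m - 1)

/-- The sequence `(x i, x (i + 1), …)`. -/
def shift (i : ℕ) (x : ℕ → A) : ℕ → A := fun k => x (i + k)

theorem seq_update {N : ℕ} [DecidableEq (Fin N)] (x : Fin N → A) (j : Fin N) (a : A) :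
    seq (Function.update x j a) = Function.update (seq x) (j : ℕ) a := by
  funext k
  by_cases h : k = j
  · subst h; simp [seq]
  · by_cases hk : k < N
    · have : (⟨k, hk⟩ : Fin N) ≠ j := fun e => h (by rw [← e])
      simp [seq, hk, Function.update_of_ne h, Function.update_of_ne this]
    · simp [seq, hk, Function.update_of_ne h]

theorem Coch.ev_congr {n : ℕ} (f : Coch K A n) {x y : ℕ → A} (h : ∀ k < n, x k = y k) :
    f.ev x = f.ev y :=
  congrArg f (funext fun j => h j j.2)

theorem ev_seq {n : ℕ} (f : Coch K A n) (x : Fin n → A) : f.ev (seq x) = f x := by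
  simp [Coch.ev, seq]

theorem ev_update_lt {n : ℕ} (f : Coch K A n) (x : ℕ → A) (j : ℕ) (hj : j < n) (a : A) :
    f.ev (Function.update x j a) = f (Function.update (fun k : Fin n => x k) ⟨j, hj⟩ a) := by
  unfold Coch.ev
  congr 1
  funext k
  by_cases h : k = ⟨j, hj⟩
  · subst h; simp
  · have : (k : ℕ) ≠ j := fun e => h (Fin.ext e)
    simp [Function.update_of_ne h, Function.update_of_ne this]

theorem ev_update_add {n : ℕ} (f : Coch K A n) (x : ℕ → A) (j : ℕ) (hj : j < n) (a b : A) :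
    f.ev (Function.update x j (a + b)) =
      f.ev (Function.update x j a) + f.ev (Function.update x j b) := by
  simp only [ev_update_lt f x j hj, f.map_update_add]

theorem ev_update_smul {n : ℕ} (f : Coch K A n) (x : ℕ → A) (j : ℕ) (hj : j < n) (c : K) (a : A) :
    f.ev (Function.update x j (c • a)) = c • f.ev (Function.update x j a) := by
  simp only [ev_update_lt f x j hj, f.map_update_smul]

theorem ins_eq_update (i m : ℕ) (a : A) (x : ℕ → A) :
    ins i m a x = Function.update (ins i m 0 x) i a := by
  funext j
  by_cases h : j = i
  · subst h; simp [ins]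
  · simp [ins, h]

theorem ev_ins_add {n : ℕ} (f : Coch K A n) (i m : ℕ) (hi : i < n) (a b : A) (x : ℕ → A) :
    f.ev (ins i m (a + b) x) = f.ev (ins i m a x) + f.ev (ins i m b x) := by
  rw [ins_eq_update, ev_update_add f _ _ hi, ← ins_eq_update, ← ins_eq_update]

theorem ev_ins_smul {n : ℕ} (f : Coch K A n) (i m : ℕ) (hi : i < n) (c : K) (a : A) (x : ℕ → A) :
    f.ev (ins i m (c • a) x) = c • f.ev (ins i m a x) := by
  rw [ins_eq_update, ev_update_smul f _ _ hi, ← ins_eq_update]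

theorem ins_update_lt (i m : ℕ) (a : A) (x : ℕ → A) (j : ℕ) (b : A) (h : j < i) :
    ins i m a (Function.update x j b) = Function.update (ins i m a x) j b := by
  funext k
  simp only [ins, Function.update_apply]
  grind

theorem ins_update_mid (i m : ℕ) (a : A) (x : ℕ → A) (j : ℕ) (b : A) (h : i ≤ j) (h' : j < i + m) :
    ins i m a (Function.update x j b) = ins i m a x := by
  funext k
  simp only [ins, Function.update_apply]
  grind

theorem ins_update_ge (i m : ℕ) (a : A) (x : ℕ → A) (j : ℕ) (b : A) (h : i + m ≤ j) :
    ins i m a (Function.update x j b) = Function.update (ins i m a x) (j + 1 - m) b := by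
  funext k
  simp only [ins, Function.update_apply]
  grind

theorem ev_shift_update_out {m : ℕ} (g : Coch K A m) (i : ℕ) (x : ℕ → A) (j : ℕ) (b : A)
    (h : j < i ∨ i + m ≤ j) :
    g.ev (shift i (Function.update x j b)) = g.ev (shift i x) := by
  refine g.ev_congr fun k hk => ?_
  simp only [shift, Function.update_apply]
  grind

theorem shift_update (i : ℕ) (x : ℕ → A) (j : ℕ) (b : A) (h : i ≤ j) :
    shift i (Function.update x j b) = Function.update (shift i x) (j - i) b := by
  funext k
  simp only [shift, Function.update_apply]
  grind

/-- The insertion `f ∘_i g`, with `i` counted from `0`: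
`(f ∘_i g)(x) = f (x 0, …, x (i - 1), g (x i, …, x (i + m - 1)), x (i + m), …, x (n + m - 2))`. -/
def circAt {n m N : ℕ} (h : n + m = N + 1) (f : Coch K A n) (g : Coch K A m) (i : Fin n) :
    Coch K A N where
  toFun x := f.ev (ins i m (g.ev (shift i (seq x))) (seq x))
  map_update_add' := by
    intro _ x j a b
    have hi := i.2
    have hj := j.2
    simp only [seq_update]
    rcases lt_or_ge (j : ℕ) i with h1 | h1
    · simp only [ev_shift_update_out g i _ _ _ (Or.inl h1), ins_update_lt _ _ _ _ _ _ h1]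
      exact ev_update_add f _ _ (by omega) _ _
    rcases lt_or_ge (j : ℕ) (i + m) with h2 | h2
    · simp only [ins_update_mid _ _ _ _ _ _ h1 h2, shift_update _ _ _ _ h1]
      rw [ev_update_add g _ _ (by omega), ev_ins_add f _ _ hi]
    · simp only [ev_shift_update_out g i _ _ _ (Or.inr h2), ins_update_ge _ _ _ _ _ _ h2]
      exact ev_update_add f _ _ (by omega) _ _
  map_update_smul' := by
    intro _ x j c a
    have hi := i.2
    have hj := j.2
    simp only [seq_update]
    rcases lt_or_ge (j : ℕ) i with h1 | h1
    · simp only [ev_shift_update_out g i _ _ _ (Or.inl h1), ins_update_lt _ _ _ _ _ _ h1]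
      exact ev_update_smul f _ _ (by omega) _ _
    rcases lt_or_ge (j : ℕ) (i + m) with h2 | h2
    · simp only [ins_update_mid _ _ _ _ _ _ h1 h2, shift_update _ _ _ _ h1]
      rw [ev_update_smul g _ _ (by omega), ev_ins_smul f _ _ hi]
    · simp only [ev_shift_update_out g i _ _ _ (Or.inr h2), ins_update_ge _ _ _ _ _ _ h2]
      exact ev_update_smul f _ _ (by omega) _ _

theorem ev_circAt {n m N : ℕ} (h : n + m = N + 1) (f : Coch K A n) (g : Coch K A m) (i : Fin n)
    (x : ℕ → A) : (circAt h f g i).ev x = f.ev (ins i m (g.ev (shift i x)) x) := by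
  have hi := i.2
  have hs : ∀ k < N, seq (fun j : Fin N => x j) k = x k := fun k hk => by simp [seq, hk]
  change f.ev (ins i m (g.ev (shift i (seq fun j : Fin N => x j))) (seq fun j : Fin N => x j)) = _
  rw [g.ev_congr (x := shift i (seq fun j : Fin N => x j)) (y := shift i x)
    fun k hk => hs _ (by omega)]
  refine f.ev_congr fun k hk => ?_
  simp only [ins]
  split_ifs with h1 h2
  · exact hs _ (by omega)
  · rfl
  · exact hs _ (by omega)

theorem ev_add {n : ℕ} (f g : Coch K A n) (x : ℕ → A) : (f + g).ev x = f.ev x + g.ev x := rfl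
theorem ev_sub {n : ℕ} (f g : Coch K A n) (x : ℕ → A) : (f - g).ev x = f.ev x - g.ev x := rfl
theorem ev_neg {n : ℕ} (f : Coch K A n) (x : ℕ → A) : (-f).ev x = -f.ev x := rfl
theorem ev_smul {n : ℕ} (c : K) (f : Coch K A n) (x : ℕ → A) : (c • f).ev x = c • f.ev x := rfl
theorem ev_zsmul {n : ℕ} (c : ℤ) (f : Coch K A n) (x : ℕ → A) : (c • f).ev x = c • f.ev x := rfl
theorem ev_sum {n : ℕ} {ι : Type*} (s : Finset ι) (f : ι → Coch K A n) (x : ℕ → A) :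
    (∑ i ∈ s, f i).ev x = ∑ i ∈ s, (f i).ev x := by
  simp [Coch.ev]

theorem Coch.ext_ev {n : ℕ} {f g : Coch K A n} (h : ∀ x, f.ev x = g.ev x) : f = g := by
  ext x
  rw [← ev_seq f, h, ev_seq]

/-- The Gerstenhaber product `f ∘ g = ∑_i (-1) ^ (i (m - 1)) f ∘_i g`, for `i = 0, …, n - 1`; it is
bilinear. (The exponent `i * (m + 1)` has the parity of `i (m - 1)` and makes sense for `m = 0`.) -/
def circ {n m N : ℕ} (h : n + m = N + 1) : Coch K A n →ₗ[K] Coch K A m →ₗ[K] Coch K A N :=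
  LinearMap.mk₂ K (fun f g => ∑ i : Fin n, (-1 : ℤ) ^ ((i : ℕ) * (m + 1)) • circAt h f g i)
    (fun f f' g => by
      refine Coch.ext_ev fun x => ?_
      simp only [ev_sum, ev_zsmul, ev_circAt, ev_add, smul_add, Finset.sum_add_distrib])
    (fun c f g => by
      refine Coch.ext_ev fun x => ?_
      simp only [ev_sum, ev_zsmul, ev_circAt, ev_smul, Finset.smul_sum]
      exact Finset.sum_congr rfl fun i _ => smul_comm _ _ _)
    (fun f g g' => by
      refine Coch.ext_ev fun x => ?_
      simp only [ev_sum, ev_zsmul, ev_circAt, ev_add, ev_ins_add f _ _ (Fin.is_lt _), smul_add,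
        Finset.sum_add_distrib])
    (fun c f g => by
      refine Coch.ext_ev fun x => ?_
      simp only [ev_sum, ev_zsmul, ev_circAt, ev_smul, ev_ins_smul f _ _ (Fin.is_lt _),
        Finset.smul_sum]
      exact Finset.sum_congr rfl fun i _ => smul_comm _ _ _)

theorem ev_circ {n m N : ℕ} (h : n + m = N + 1) (f : Coch K A n) (g : Coch K A m) (x : ℕ → A) :
    (circ h f g).ev x = ∑ i ∈ Finset.range n,
      (-1 : ℤ) ^ (i * (m + 1)) • f.ev (ins i m (g.ev (shift i x)) x) := by
  simp only [circ, LinearMap.mk₂_apply, ev_sum, ev_zsmul, ev_circAt]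
  exact Fin.sum_univ_eq_sum_range
    (fun i => (-1 : ℤ) ^ (i * (m + 1)) • f.ev (ins i m (g.ev (shift i x)) x)) n

/-- The Gerstenhaber bracket of cochains,
`[f, g] = f ∘ g - (-1) ^ ((n - 1) (m - 1)) g ∘ f`. -/
def gerst {n m N : ℕ} (h : n + m = N + 1) (f : Coch K A n) (g : Coch K A m) : Coch K A N :=
  circ h f g - (-1 : ℤ) ^ ((n + 1) * (m + 1)) • circ ((add_comm m n).trans h) g f

/-- The multiplication of `A` as a `2`-cochain. -/
def mulCoch : Coch K A 2 := MultilinearMap.mkPiAlgebraFin K 2 A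

theorem ev_mulCoch (x : ℕ → A) : (mulCoch : Coch K A 2).ev x = x 0 * x 1 := by
  simp [mulCoch, Coch.ev, MultilinearMap.mkPiAlgebraFin_apply]

theorem sum_triangle {M : Type*} [AddCommMonoid M] (n : ℕ) (G : ℕ → ℕ → M) :
    ∑ i ∈ Finset.range n, ∑ k ∈ Finset.range i, G k i =
      ∑ k ∈ Finset.range n, ∑ l ∈ Finset.range (n - 1 - k), G k (k + 1 + l) := by
  rw [Finset.sum_sigma', Finset.sum_sigma']
  refine Finset.sum_nbij' (fun s => ⟨s.2, s.1 - 1 - s.2⟩) (fun s => ⟨s.1 + 1 + s.2, s.1⟩)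
    ?_ ?_ ?_ ?_ ?_
  · rintro ⟨i, k⟩ h; simp at h ⊢; omega
  · rintro ⟨i, k⟩ h; simp at h ⊢; omega
  · rintro ⟨i, k⟩ h; simp at h ⊢; omega
  · rintro ⟨i, k⟩ h; simp at h ⊢
  · rintro ⟨i, k⟩ h
    simp at h
    have : k + 1 + (i - 1 - k) = i := by omega
    simp only [this]

theorem sign_congr {a b : ℕ} (h : a % 2 = b % 2) : (-1 : ℤ) ^ a = (-1) ^ b := by
  rw [neg_one_pow_eq_pow_mod_two, h, ← neg_one_pow_eq_pow_mod_two]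

/-- The insertions of `g` and `h` at two different places of `f`, with `g` to the left of `h`. -/
def twoIns {n m p : ℕ} (f : Coch K A n) (g : Coch K A m) (h : Coch K A p) (x : ℕ → A) : A :=
  ∑ i ∈ Finset.range n, ∑ l ∈ Finset.range (n - 1 - i),
    (-1 : ℤ) ^ ((i + m + l) * (p + 1) + i * (m + 1)) •
      f.ev (ins i m (g.ev (shift i x)) (ins (i + m + l) p (h.ev (shift (i + m + l) x)) x))

theorem ev_assoc {n m p N₁ N₂ N : ℕ} (h₁ : n + m = N₁ + 1) (h₂ : N₁ + p = N + 1)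
    (h₃ : m + p = N₂ + 1) (h₄ : n + N₂ = N + 1)
    (f : Coch K A n) (g : Coch K A m) (h : Coch K A p) (x : ℕ → A) :
    (circ h₂ (circ h₁ f g) h).ev x = (circ h₄ f (circ h₃ g h)).ev x +
      (twoIns f g h x + (-1 : ℤ) ^ ((m + 1) * (p + 1)) • twoIns f h g x) := by
  have key : ∀ i ∈ Finset.range n, ∀ F : ℕ → A, ∑ k ∈ Finset.range N₁, F k =
      ∑ k ∈ Finset.range i, F k + ∑ l ∈ Finset.range m, F (i + l) +
        ∑ l ∈ Finset.range (n - 1 - i), F (i + m + l) := by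
    intro i hi F
    have hi := Finset.mem_range.1 hi
    have : N₁ = (i + m) + (n - 1 - i) := by omega
    rw [this, Finset.sum_range_add, Finset.sum_range_add]
  rw [ev_circ]
  simp only [ev_circ, Finset.smul_sum]
  rw [Finset.sum_comm, Finset.sum_congr rfl fun i hi => key i hi _]
  rw [Finset.sum_add_distrib, Finset.sum_add_distrib]
  have e1 : ∑ i ∈ Finset.range n, ∑ l ∈ Finset.range m, (-1 : ℤ) ^ ((i + l) * (p + 1)) •
      (-1 : ℤ) ^ (i * (m + 1)) • f.ev (ins i m
        (g.ev (shift i (ins (i + l) p (h.ev (shift (i + l) x)) x)))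
          (ins (i + l) p (h.ev (shift (i + l) x)) x)) =
      ∑ i ∈ Finset.range n, (-1 : ℤ) ^ (i * (N₂ + 1)) • f.ev (ins i N₂
        (∑ l ∈ Finset.range m, (-1 : ℤ) ^ (l * (p + 1)) •
          g.ev (ins l p (h.ev (shift l (shift i x))) (shift i x))) x) := by
    refine Finset.sum_congr rfl fun i hi => ?_
    have hi := Finset.mem_range.1 hi
    let φ : A →+ A := AddMonoidHom.mk' (fun a => f.ev (ins i N₂ a x))
      fun a b => ev_ins_add f i N₂ hi a b x
    change _ = (-1 : ℤ) ^ (i * (N₂ + 1)) • φ _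
    rw [map_sum, Finset.smul_sum]
    refine Finset.sum_congr rfl fun l hl => ?_
    have hl := Finset.mem_range.1 hl
    rw [map_zsmul, smul_smul, smul_smul, ← pow_add, ← pow_add]
    change _ = _ • f.ev (ins i N₂ _ x)
    have s1 : shift i (ins (i + l) p (h.ev (shift (i + l) x)) x) =
        ins l p (h.ev (shift l (shift i x))) (shift i x) := by
      have : shift l (shift i x) = shift (i + l) x := by
        funext k; simp only [shift]; congr 1; omega
      rw [this]
      funext k
      simp only [shift, ins]
      grind
    have s2 : ∀ a b, ins i m a (ins (i + l) p b x) = ins i N₂ a x := by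
      intro a b
      funext k
      simp only [ins]
      grind
    rw [s1, s2]
    congr 1
    apply sign_congr
    have : i * (N₂ + 1) = i * (m + p) := by rw [h₃]
    rw [this]
    have : (i + l) * (p + 1) + i * (m + 1) = i * (m + p) + l * (p + 1) + 2 * i := by ring
    omega
  have e2 : ∑ i ∈ Finset.range n, ∑ k ∈ Finset.range i, (-1 : ℤ) ^ (k * (p + 1)) •
      (-1 : ℤ) ^ (i * (m + 1)) • f.ev (ins i m
        (g.ev (shift i (ins k p (h.ev (shift k x)) x)))
          (ins k p (h.ev (shift k x)) x)) =
      (-1 : ℤ) ^ ((m + 1) * (p + 1)) • twoIns f h g x := by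
    rw [sum_triangle n fun k i => (-1 : ℤ) ^ (k * (p + 1)) •
      (-1 : ℤ) ^ (i * (m + 1)) • f.ev (ins i m
        (g.ev (shift i (ins k p (h.ev (shift k x)) x)))
          (ins k p (h.ev (shift k x)) x))]
    simp only [twoIns, Finset.smul_sum]
    refine Finset.sum_congr rfl fun k hk => Finset.sum_congr rfl fun l hl => ?_
    rw [smul_smul, smul_smul, ← pow_add, ← pow_add]
    have s1 : shift (k + 1 + l) (ins k p (h.ev (shift k x)) x) = shift (k + p + l) x := by
      funext j
      simp only [shift, ins]
      grind
    have s2 : ∀ a b, ins (k + 1 + l) m a (ins k p b x) = ins k p b (ins (k + p + l) m a x) := by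
      intro a b
      funext j
      simp only [ins]
      grind
    rw [s1, s2]
    congr 1
    apply sign_congr
    have : (m + 1) * (p + 1) + ((k + p + l) * (m + 1) + k * (p + 1)) =
      k * (p + 1) + (k + 1 + l) * (m + 1) + 2 * (p * (m + 1)) := by ring
    omega
  have e3 : ∑ i ∈ Finset.range n, ∑ l ∈ Finset.range (n - 1 - i),
      (-1 : ℤ) ^ ((i + m + l) * (p + 1)) • (-1 : ℤ) ^ (i * (m + 1)) • f.ev (ins i m
        (g.ev (shift i (ins (i + m + l) p (h.ev (shift (i + m + l) x)) x)))
          (ins (i + m + l) p (h.ev (shift (i + m + l) x)) x)) = twoIns f g h x := by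
    simp only [twoIns]
    refine Finset.sum_congr rfl fun i hi => Finset.sum_congr rfl fun l hl => ?_
    rw [smul_smul, ← pow_add]
    have s1 : g.ev (shift i (ins (i + m + l) p (h.ev (shift (i + m + l) x)) x)) =
        g.ev (shift i x) := by
      refine g.ev_congr fun k hk => ?_
      simp only [shift, ins]
      grind
    rw [s1]
  rw [e1, e2, e3]
  abel

/-- The graded right pre-Lie identity. -/
theorem assoc_symm {n m p N₁ N₁' N₂ N₂' N : ℕ} (h₁ : n + m = N₁ + 1) (h₂ : N₁ + p = N + 1)
    (h₃ : m + p = N₂ + 1) (h₄ : n + N₂ = N + 1)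
    (h₁' : n + p = N₁' + 1) (h₂' : N₁' + m = N + 1)
    (h₃' : p + m = N₂' + 1) (h₄' : n + N₂' = N + 1)
    (f : Coch K A n) (g : Coch K A m) (h : Coch K A p) :
    circ h₂ (circ h₁ f g) h - circ h₄ f (circ h₃ g h) =
      (-1 : ℤ) ^ ((m + 1) * (p + 1)) •
        (circ h₂' (circ h₁' f h) g - circ h₄' f (circ h₃' h g)) := by
  refine Coch.ext_ev fun x => ?_
  have hs : (-1 : ℤ) ^ ((m + 1) * (p + 1)) * (-1 : ℤ) ^ ((m + 1) * (p + 1)) = 1 := by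
    rw [← pow_add, ← two_mul, pow_mul]; simp
  rw [ev_sub, ev_zsmul, ev_sub, ev_assoc h₁ h₂ h₃ h₄, ev_assoc h₁' h₂' h₃' h₄', mul_comm (p + 1)]
  rw [add_sub_cancel_left, add_sub_cancel_left, smul_add, smul_smul, hs, one_smul, add_comm]

theorem d_aux {n : ℕ} (f : Coch K A n) (x : Fin (n + 1) → A) :
    x 0 * f (Fin.tail x)
      + ∑ i : Fin n, (-1 : ℤ) ^ ((i : ℕ) + 1) • f (Fin.contractNth i.castSucc (· * ·) x)
      + (-1 : ℤ) ^ (n + 1) • (f (Fin.init x) * x (Fin.last n)) =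
    ((-1 : ℤ) ^ (n + 1) • circ (show 2 + n = (n + 1) + 1 by omega) mulCoch f -
      circ (show n + 2 = (n + 1) + 1 by omega) f mulCoch) x := by
  have hs : (-1 : ℤ) ^ (n + 1) * (-1 : ℤ) ^ (n + 1) = 1 := by
    rw [← pow_add, ← two_mul, pow_mul]; simp
  have hx : ∀ k (hk : k < n + 1), seq x k = x ⟨k, hk⟩ := fun k hk => by simp [seq, hk]
  rw [← ev_seq (_ - _) x, ev_sub, ev_zsmul, ev_circ, ev_circ]
  simp only [Finset.sum_range_succ, Finset.sum_range_zero, ev_mulCoch, zero_add, zero_mul,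
    pow_zero, one_smul, one_mul, smul_add, smul_smul, hs]
  have t0 : f (Fin.tail x) = f.ev (shift 1 (seq x)) := by
    refine congrArg f (funext fun j => ?_)
    simp only [shift]
    rw [hx _ (by omega)]
    simp only [Fin.tail]
    congr 1
    ext; simp; omega
  have t1 : f (Fin.init x) = f.ev (shift 0 (seq x)) := by
    refine congrArg f (funext fun j => ?_)
    simp only [shift]
    rw [hx _ (by omega)]
    simp only [Fin.init]
    congr 1
    ext; simp
  have t2 : ∑ i : Fin n, (-1 : ℤ) ^ ((i : ℕ) + 1) • f (Fin.contractNth i.castSucc (· * ·) x) =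
      - ∑ i ∈ Finset.range n, (-1 : ℤ) ^ (i * (2 + 1)) •
        f.ev (ins i 2 (shift i (seq x) 0 * shift i (seq x) 1) (seq x)) := by
    rw [← Fin.sum_univ_eq_sum_range (fun i => (-1 : ℤ) ^ (i * (2 + 1)) •
        f.ev (ins i 2 (shift i (seq x) 0 * shift i (seq x) 1) (seq x))) n, ← Finset.sum_neg_distrib]
    refine Finset.sum_congr rfl fun i _ => ?_
    rw [pow_succ, mul_neg_one, neg_smul, sign_congr (show (i : ℕ) % 2 = (i * (2 + 1)) % 2 by omega)]
    congr 2
    refine congrArg f (funext fun j => ?_)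
    have hi := i.2
    have hj := j.2
    simp only [ins, shift, Fin.contractNth, Fin.val_castSucc]
    split_ifs with h1 h2
    · rw [hx _ (by omega)]; rfl
    · rw [hx _ (by omega), hx _ (by omega)]
      congr 2 <;> ext <;> simp [h2]
    · rw [hx _ (by omega)]
      congr 1
  have u0 : ins 0 n (f.ev (shift 0 (seq x))) (seq x) 0 = f.ev (shift 0 (seq x)) := by simp [ins]
  have u1 : ins 0 n (f.ev (shift 0 (seq x))) (seq x) 1 = x (Fin.last n) := by
    simp only [ins]
    simp only [Nat.not_lt_zero, if_false, one_ne_zero]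
    rw [show 1 + n - 1 = n by omega, hx n (by omega)]
    rfl
  have u2 : ins 1 n (f.ev (shift 1 (seq x))) (seq x) 0 = x 0 := by
    simp only [ins]
    rw [if_pos (by omega), hx 0 (by omega)]
    rfl
  have u3 : ins 1 n (f.ev (shift 1 (seq x))) (seq x) 1 = f.ev (shift 1 (seq x)) := by simp [ins]
  rw [t0, t1, t2, u0, u1, u2, u3]
  abel

/-- The Hochschild differential `C ^ n (A) → C ^ (n + 1) (A)`,
`(δ f)(x 0, …, x n) = x 0 * f (x 1, …, x n) + ∑_{i < n} (-1) ^ (i + 1) f (…, x i * x (i + 1), …)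
  + (-1) ^ (n + 1) f (x 0, …, x (n - 1)) * x n`. -/
def d (n : ℕ) : Coch K A n →ₗ[K] Coch K A (n + 1) where
  toFun f :=
    { toFun := fun x =>
        x 0 * f (Fin.tail x)
          + ∑ i : Fin n, (-1 : ℤ) ^ ((i : ℕ) + 1) • f (Fin.contractNth i.castSucc (· * ·) x)
          + (-1 : ℤ) ^ (n + 1) • (f (Fin.init x) * x (Fin.last n))
      map_update_add' := by
        intro _ x j a b
        simp only [d_aux]
        convert MultilinearMap.map_update_add _ x j a b
      map_update_smul' := by
        intro _ x j c a
        simp only [d_aux]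
        convert MultilinearMap.map_update_smul _ x j c a }
  map_add' f g := by
    refine MultilinearMap.ext fun x => (d_aux (f + g) x).trans ?_
    have e : ∀ u v w z : Coch K A (n + 1), u + v - (w + z) = (u - w) + (v - z) := by
      intros; abel
    rw [map_add, map_add, LinearMap.add_apply, smul_add, e]
    exact (congrArg₂ (· + ·) (d_aux f x) (d_aux g x)).symm
  map_smul' c f := by
    refine MultilinearMap.ext fun x => (d_aux (c • f) x).trans ?_
    have e : ∀ u v : Coch K A (n + 1), c • u - c • v = c • (u - v) := by
      intro u v
      exact (smul_sub c u v).symm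
    rw [map_smul, map_smul, LinearMap.smul_apply, smul_comm _ c, e]
    exact (congrArg (c • ·) (d_aux f x)).symm

theorem d_eq {n : ℕ} (f : Coch K A n) :
    d n f = (-1 : ℤ) ^ (n + 1) • circ (show 2 + n = (n + 1) + 1 by omega) mulCoch f -
      circ (show n + 2 = (n + 1) + 1 by omega) f mulCoch := by
  ext x
  exact d_aux f x

theorem sign_even {a : ℕ} (h : a % 2 = 0) : (-1 : ℤ) ^ a = 1 := by
  rw [sign_congr (show a % 2 = 0 % 2 by omega), pow_zero]

theorem sign_odd {a : ℕ} (h : a % 2 = 1) : (-1 : ℤ) ^ a = -1 := by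
  rw [sign_congr (show a % 2 = 1 % 2 by omega), pow_one]

theorem mul_odd {a b : ℕ} (h : a % 2 = 1 ∨ b % 2 = 1) : ((a + 1) * (b + 1)) % 2 = 0 := by
  rcases h with h | h <;> rw [Nat.mul_mod]
  · rw [show (a + 1) % 2 = 0 by omega]; simp
  · rw [show (b + 1) % 2 = 0 by omega]; simp

theorem gerst_odd {n m N : ℕ} (h : n + m = N + 1) (ho : n % 2 = 1 ∨ m % 2 = 1)
    (f : Coch K A n) (g : Coch K A m) :
    gerst h f g = circ h f g - circ ((add_comm m n).trans h) g f := by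
  rw [gerst, sign_even (mul_odd ho), one_smul]

theorem d_odd {n : ℕ} (hn : n % 2 = 1) (f : Coch K A n) :
    d n f = circ (show 2 + n = (n + 1) + 1 by omega) mulCoch f -
      circ (show n + 2 = (n + 1) + 1 by omega) f mulCoch := by
  rw [d_eq, sign_even (by omega), one_smul]

theorem d_even {n : ℕ} (hn : n % 2 = 0) (f : Coch K A n) :
    d n f = - circ (show 2 + n = (n + 1) + 1 by omega) mulCoch f -
      circ (show n + 2 = (n + 1) + 1 by omega) f mulCoch := by
  rw [d_eq, sign_odd (by omega), neg_one_zsmul]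

/-- The bracket of two cocycles of odd degree is a cocycle. -/
theorem d_gerst_odd {a b N : ℕ} (h : a + b = N + 1) (ha : a % 2 = 1) (hb : b % 2 = 1)
    (f : Coch K A a) (g : Coch K A b) (hf : d _ f = 0) (hg : d _ g = 0) :
    d _ (gerst h f g) = 0 := by
  have A1 := assoc_symm (N := N + 1) h (by omega) (N₂ := b + 1) (by omega) (by omega)
    (N₁' := a + 1) (by omega) (by omega) (N₂' := b + 1) (by omega) (by omega)
    f g (mulCoch : Coch K A 2)
  have A2 := assoc_symm (N := N + 1) ((add_comm b a).trans h) (by omega)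
    (N₂ := a + 1) (by omega) (by omega)
    (N₁' := b + 1) (by omega) (by omega) (N₂' := a + 1) (by omega) (by omega)
    g f (mulCoch : Coch K A 2)
  have A3 := assoc_symm (N := N + 1) (N₁ := a + 1) (by omega) (by omega) h (by omega)
    (N₁' := b + 1) (by omega) (by omega) ((add_comm b a).trans h) (by omega)
    (mulCoch : Coch K A 2) f g
  rw [sign_even (mul_odd (by omega)), one_smul] at A1 A2 A3
  rw [d_odd ha, sub_eq_zero] at hf
  rw [d_odd hb, sub_eq_zero] at hg
  rw [d_odd (by omega), gerst_odd h (Or.inl ha)]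
  rw [hg] at A1 A3
  rw [hf] at A2 A3
  simp only [map_sub, LinearMap.sub_apply]
  grind

/-- The bracket of a cocycle of odd degree with a coboundary of odd degree is a coboundary. -/
theorem gerst_d {a b N : ℕ} (h : a + b = N + 1) (ha : a % 2 = 1) (hb : b % 2 = 0)
    (f : Coch K A a) (g : Coch K A b) (hf : d _ f = 0) :
    gerst (show a + (b + 1) = (N + 1) + 1 by omega) f (d _ g) = d _ (gerst h f g) := by
  have h' := (add_comm b a).trans h
  have A1 := assoc_symm (N := N + 1) h (by omega) (N₂ := b + 1) (by omega) (by omega)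
    (N₁' := a + 1) (by omega) (by omega) (N₂' := b + 1) (by omega) (by omega)
    f g (mulCoch : Coch K A 2)
  have A2 := assoc_symm (N := N + 1) h' (by omega)
    (N₂ := a + 1) (by omega) (by omega)
    (N₁' := b + 1) (by omega) (by omega) (N₂' := a + 1) (by omega) (by omega)
    g f (mulCoch : Coch K A 2)
  have A3 := assoc_symm (N := N + 1) (N₁ := a + 1) (by omega) (by omega) h (by omega)
    (N₁' := b + 1) (by omega) (by omega) h' (by omega)
    (mulCoch : Coch K A 2) f g
  rw [sign_odd (by rw [Nat.mul_mod, show (b + 1) % 2 = 1 by omega]), neg_one_zsmul] at A1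
  rw [sign_even (mul_odd (by omega)), one_smul] at A2 A3
  rw [d_odd ha, sub_eq_zero] at hf
  rw [d_even hb, d_even (by omega), gerst_odd h (Or.inl ha), gerst_odd _ (Or.inl ha)]
  rw [hf] at A2 A3
  simp only [map_sub, map_neg, LinearMap.sub_apply, LinearMap.neg_apply]
  grind

end Cochains

section Odd

variable (K : Type*) (A : Type*) [CommRing K] [Ring A] [Algebra K A]

/-- The cochains of odd degree, `⨁ r, C ^ (2 r + 1) (A)`. -/
def OddCoch : Type _ := ⨁ r : ℕ, Coch K A (2 * r + 1)

instance : AddCommGroup (OddCoch K A) :=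
  inferInstanceAs (AddCommGroup (⨁ r : ℕ, Coch K A (2 * r + 1)))

instance : Module K (OddCoch K A) :=
  inferInstanceAs (Module K (⨁ r : ℕ, Coch K A (2 * r + 1)))

variable {K A}

/-- The inclusion of `C ^ (2 r + 1) (A)`. -/
def single (r : ℕ) : Coch K A (2 * r + 1) →ₗ[K] OddCoch K A :=
  DirectSum.lof K ℕ (fun r => Coch K A (2 * r + 1)) r

/-- The component of degree `2 r + 1`. -/
def coord (r : ℕ) : OddCoch K A →ₗ[K] Coch K A (2 * r + 1) :=
  DirectSum.component K ℕ (fun r => Coch K A (2 * r + 1)) r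

theorem coord_single_same (r : ℕ) (f : Coch K A (2 * r + 1)) : coord r (single r f) = f :=
  DirectSum.component.lof_self K r (M := fun r => Coch K A (2 * r + 1)) f

theorem coord_single_ne {r s : ℕ} (h : r ≠ s) (f : Coch K A (2 * r + 1)) :
    coord s (single r f) = 0 :=
  DirectSum.of_eq_of_ne _ _ _ h.symm

/-- An odd cochain is the sum of its components. -/
theorem mem_of_components {S : AddSubmonoid (OddCoch K A)} {F : OddCoch K A}
    (h : ∀ r, single r (coord r F) ∈ S) : F ∈ S := by
  classical
  have : ∑ r ∈ DFinsupp.support (show ⨁ r : ℕ, Coch K A (2 * r + 1) from F),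
      single r (coord r F) = F := DirectSum.sum_support_of (β := fun r => Coch K A (2 * r + 1)) F
  rw [← this]
  exact sum_mem fun r _ => h r

theorem odd_induction {P : OddCoch K A → Prop} (F : OddCoch K A) (h0 : P 0)
    (h1 : ∀ r f, P (single r f)) (h2 : ∀ F G, P F → P G → P (F + G)) : P F :=
  mem_of_components (S := { carrier := {F | P F}, zero_mem' := h0, add_mem' := h2 _ _ })
    fun r => h1 r _

theorem single_congr {r s : ℕ} (h : r = s) {f : Coch K A (2 * r + 1)} {g : Coch K A (2 * s + 1)}
    (hfg : ∀ x, f.ev x = g.ev x) : single r f = single s g := by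
  subst h
  rw [Coch.ext_ev hfg]

theorem odd_add (r s : ℕ) : (2 * r + 1) + (2 * s + 1) = (2 * (r + s) + 1) + 1 := by omega

/-- The linear map on `⨁ r, C ^ (2 r + 1) (A)` with given restrictions to the summands. -/
def oddLift {M : Type*} [AddCommGroup M] [Module K M] (φ : ∀ r, Coch K A (2 * r + 1) →ₗ[K] M) :
    OddCoch K A →ₗ[K] M :=
  DirectSum.toModule K ℕ M φ

theorem oddLift_single {M : Type*} [AddCommGroup M] [Module K M]
    (φ : ∀ r, Coch K A (2 * r + 1) →ₗ[K] M) (r : ℕ) (f : Coch K A (2 * r + 1)) :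
    oddLift φ (single r f) = φ r f :=
  DirectSum.toModule_lof K (M := fun r => Coch K A (2 * r + 1)) r f

/-- The Gerstenhaber product of odd cochains. -/
def circOdd : OddCoch K A →ₗ[K] OddCoch K A →ₗ[K] OddCoch K A :=
  oddLift fun r => LinearMap.flip <| oddLift fun s => LinearMap.flip <|
    (circ (odd_add r s)).compr₂ (single (r + s))

theorem circOdd_single (r s : ℕ) (f : Coch K A (2 * r + 1)) (g : Coch K A (2 * s + 1)) :
    circOdd (single r f) (single s g) = single (r + s) (circ (odd_add r s) f g) := by
  simp only [circOdd, oddLift_single, LinearMap.flip_apply, LinearMap.compr₂_apply]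

theorem circOdd_assoc (F G H : OddCoch K A) :
    circOdd (circOdd F G) H - circOdd F (circOdd G H) =
      circOdd (circOdd F H) G - circOdd F (circOdd H G) := by
  induction F using odd_induction with
  | h0 => simp
  | h2 F F' h h' => simp only [map_add, LinearMap.add_apply]; grind
  | h1 r f =>
  induction G using odd_induction with
  | h0 => simp
  | h2 F F' h h' => simp only [map_add, LinearMap.add_apply]; grind
  | h1 s g =>
  induction H using odd_induction with
  | h0 => simp
  | h2 F F' h h' => simp only [map_add, LinearMap.add_apply]; grind
  | h1 t h =>
  have A := assoc_symm (N := 2 * (r + s + t) + 1) (odd_add r s) (odd_add (r + s) t) (odd_add s t)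
    (by omega) (odd_add r t) (by omega) (odd_add t s) (by omega) f g h
  rw [sign_even (mul_odd (by omega)), one_smul] at A
  have A' := congrArg (single (r + s + t)) A
  simp only [map_sub] at A'
  simp only [circOdd_single]
  convert A' using 2 <;> refine single_congr (by omega) fun x => ?_ <;> simp only [ev_circ]

/-- The Lie algebra of cochains of odd degree, with the Gerstenhaber bracket
`[F, G] = F ∘ G - G ∘ F` (the sign `(-1) ^ ((n - 1) (m - 1))` is `1` in odd degrees `n`, `m`). -/
instance : LieRing (OddCoch K A) where
  bracket F G := circOdd F G - circOdd G F
  add_lie F G H := by simp only [map_add, LinearMap.add_apply]; abel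
  lie_add F G H := by simp only [map_add, LinearMap.add_apply]; abel
  lie_self F := sub_self _
  leibniz_lie F G H := by
    have h1 := circOdd_assoc F G H
    have h2 := circOdd_assoc G F H
    have h3 := circOdd_assoc H F G
    simp only [map_sub, LinearMap.sub_apply]
    grind

instance : LieAlgebra K (OddCoch K A) where
  lie_smul c F G := by
    change circOdd F (c • G) - circOdd (c • G) F = c • (circOdd F G - circOdd G F)
    rw [map_smul, map_smul, LinearMap.smul_apply, smul_sub]

theorem lie_single (r s : ℕ) (f : Coch K A (2 * r + 1)) (g : Coch K A (2 * s + 1)) :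
    ⁅single r f, single s g⁆ = single (r + s) (gerst (odd_add r s) f g) := by
  rw [gerst_odd _ (by omega), map_sub]
  change circOdd _ _ - circOdd _ _ = _
  rw [circOdd_single, circOdd_single]
  congr 1
  exact single_congr (add_comm s r) fun x => by simp only [ev_circ]

variable (K A)

/-- The cocycles of odd degree. -/
def oddCocycles : LieSubalgebra K (OddCoch K A) where
  carrier := {F | ∀ r, d (2 * r + 1) (coord r F) = 0}
  add_mem' := by
    intro F G hF hG r
    rw [map_add, map_add, hF r, hG r, add_zero]
  zero_mem' := by intro r; simp
  smul_mem' := by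
    intro c F hF r
    rw [map_smul, map_smul, hF r, smul_zero]
  lie_mem' := by
    intro F G hF hG
    have hs : ∀ (t : ℕ) (f : Coch K A (2 * t + 1)), d _ f = 0 → ∀ r,
        d (2 * r + 1) (coord r (single t f)) = 0 := by
      intro t f hf r
      by_cases h : t = r
      · subst h; rwa [coord_single_same]
      · rw [coord_single_ne h, map_zero]
    let S : AddSubmonoid (OddCoch K A) :=
      { carrier := {F | ∀ r, d (2 * r + 1) (coord r F) = 0}
        add_mem' := by
          intro F G hF hG r
          rw [map_add, map_add, hF r, hG r, add_zero]
        zero_mem' := by intro r; simp }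
    change ⁅F, G⁆ ∈ S
    refine mem_of_components (S := S.comap (⟨⟨fun F => ⁅F, G⁆, by simp⟩, by simp⟩ :
      OddCoch K A →+ OddCoch K A)) (F := F) fun r => ?_
    change ⁅single r (coord r F), G⁆ ∈ S
    refine mem_of_components (S := S.comap (⟨⟨fun G => ⁅single r (coord r F), G⁆, by simp⟩,
      by simp⟩ : OddCoch K A →+ OddCoch K A)) (F := G) fun s => ?_
    change ⁅single r (coord r F), single s (coord s G)⁆ ∈ S
    rw [lie_single]
    exact hs _ _ (d_gerst_odd _ (by omega) (by omega) _ _ (hF r) (hG s))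

/-- The coboundaries of odd degree, an ideal of the Lie algebra of cocycles. -/
def oddCoboundaries : LieIdeal K (oddCocycles K A) where
  carrier := {F | ∀ r, ∃ h : Coch K A (2 * r), d (2 * r) h = coord r (F : OddCoch K A)}
  add_mem' := by
    intro F G hF hG r
    obtain ⟨f, hf⟩ := hF r
    obtain ⟨g, hg⟩ := hG r
    exact ⟨f + g, by rw [map_add, hf, hg]; exact (map_add (coord r) _ _).symm⟩
  zero_mem' := fun r => ⟨0, by rw [map_zero]; exact (map_zero (coord r)).symm⟩
  smul_mem' := by
    intro c F hF r
    obtain ⟨f, hf⟩ := hF r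
    exact ⟨c • f, by rw [map_smul, hf]; exact (map_smul (coord r) _ _).symm⟩
  lie_mem := by
    rintro ⟨F, hF⟩ ⟨G, hG'⟩ hG
    let S : AddSubmonoid (OddCoch K A) :=
      { carrier := {F | ∀ r, ∃ h : Coch K A (2 * r), d (2 * r) h = coord r F}
        add_mem' := by
          intro F G hF hG r
          obtain ⟨f, hf⟩ := hF r
          obtain ⟨g, hg⟩ := hG r
          exact ⟨f + g, by rw [map_add, hf, hg, map_add]⟩
        zero_mem' := fun r => ⟨0, by rw [map_zero, map_zero]⟩ }
    have hs : ∀ (t : ℕ) (f : Coch K A (2 * t)), single t (d (2 * t) f) ∈ S := by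
      intro t f r
      by_cases h : t = r
      · subst h; exact ⟨f, by rw [coord_single_same]⟩
      · exact ⟨0, by rw [coord_single_ne h, map_zero]⟩
    change ⁅F, G⁆ ∈ S
    refine mem_of_components (S := S.comap (⟨⟨fun F => ⁅F, G⁆, by simp⟩, by simp⟩ :
      OddCoch K A →+ OddCoch K A)) (F := F) fun r => ?_
    change ⁅single r (coord r F), G⁆ ∈ S
    refine mem_of_components (S := S.comap (⟨⟨fun G => ⁅single r (coord r F), G⁆, by simp⟩,
      by simp⟩ : OddCoch K A →+ OddCoch K A)) (F := G) fun s => ?_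
    change ⁅single r (coord r F), single s (coord s G)⁆ ∈ S
    obtain ⟨g, hg⟩ := hG s
    change d (2 * s) g = coord s G at hg
    rw [lie_single, ← hg, gerst_d (N := 2 * (r + s)) (by omega) (by omega) (by omega) _ _ (hF r)]
    exact hs _ _

/-- The odd part `HH ^ odd (A) = ⨁ r, HH ^ (2 r + 1) (A)` of Hochschild cohomology, as a Lie algebra
under the Gerstenhaber bracket. -/
abbrev HHodd : Type _ := oddCocycles K A ⧸ oddCoboundaries K A

variable {K A}

theorem single_mem (r : ℕ) (f : Coch K A (2 * r + 1)) (hf : d _ f = 0) :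
    single r f ∈ oddCocycles K A := by
  intro s
  by_cases h : r = s
  · subst h; rwa [coord_single_same]
  · rw [coord_single_ne h, map_zero]

variable (K A) in
/-- The space `Z ^ n (A)` of Hochschild cocycles of degree `n`. -/
abbrev Cocycle (n : ℕ) : Submodule K (Coch K A n) := LinearMap.ker (d n)

theorem Cocycle.d_eq_zero {n : ℕ} (f : Cocycle K A n) : d n (f : Coch K A n) = 0 := f.2

/-- A Hochschild cocycle of degree `2 r + 1`, as an element of `oddCocycles`. -/
def toOddCocycles (r : ℕ) : Cocycle K A (2 * r + 1) →ₗ[K] oddCocycles K A where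
  toFun f := ⟨single r (f : Coch K A (2 * r + 1)), single_mem r _ (Cocycle.d_eq_zero f)⟩
  map_add' _ _ := Subtype.ext (map_add (single r) _ _)
  map_smul' _ _ := Subtype.ext (map_smul (single r) _ _)

/-- The class in `HH ^ odd (A)` of a Hochschild cocycle of degree `2 r + 1`. -/
def cls (r : ℕ) : Cocycle K A (2 * r + 1) →ₗ[K] HHodd K A :=
  (LieSubmodule.Quotient.mk' (oddCoboundaries K A)).toLinearMap ∘ₗ toOddCocycles r

/-- The Gerstenhaber bracket of cocycles of odd degree. -/
def gerstCocycle (r s : ℕ) (f : Cocycle K A (2 * r + 1)) (g : Cocycle K A (2 * s + 1)) :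
    Cocycle K A (2 * (r + s) + 1) :=
  ⟨gerst (odd_add r s) (f : Coch K A (2 * r + 1)) (g : Coch K A (2 * s + 1)),
    LinearMap.mem_ker.2 (d_gerst_odd (odd_add r s) (by omega) (by omega) _ _
      (Cocycle.d_eq_zero f) (Cocycle.d_eq_zero g))⟩

/-- The bracket on `HH ^ odd (A)` is induced by the Gerstenhaber bracket of cochains. -/
theorem lie_cls (r s : ℕ) (f : Cocycle K A (2 * r + 1)) (g : Cocycle K A (2 * s + 1)) :
    ⁅cls r f, cls s g⁆ = cls (r + s) (gerstCocycle r s f g) := by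
  have h : toOddCocycles (r + s) (gerstCocycle r s f g) =
      ⁅toOddCocycles r f, toOddCocycles s g⁆ := Subtype.ext (lie_single r s _ _).symm
  change _ = LieSubmodule.Quotient.mk (N := oddCoboundaries K A)
    (toOddCocycles (r + s) (gerstCocycle r s f g))
  rw [h, LieSubmodule.Quotient.mk_bracket]
  rfl

variable (K A)

/-- `HH ^ 1 (A)`, the part of degree `1`, with the Gerstenhaber bracket. -/
def HH1 : LieSubalgebra K (HHodd K A) where
  __ := LinearMap.range (cls (K := K) (A := A) 0)
  lie_mem' := by
    rintro _ _ ⟨f, rfl⟩ ⟨g, rfl⟩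
    exact ⟨_, (lie_cls 0 0 f g).symm⟩

end Odd

section Derivations

variable {K A : Type*} [CommRing K] [CommRing A] [Algebra K A]

theorem d_derivation (D : Derivation K A A) :
    d 1 (MultilinearMap.ofSubsingleton K A A (0 : Fin 1) D.toLinearMap : Coch K A 1) = 0 := by
  ext x
  change x 0 * D _ + ∑ i : Fin 1, (-1 : ℤ) ^ ((i : ℕ) + 1) • D _ + (-1 : ℤ) ^ 2 • (D _ * _) = 0
  simp [Fin.tail, Fin.init, Fin.contractNth]
  ring

/-- A derivation of a commutative algebra, as an element of `HH ^ 1`. -/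
def derClass (D : Derivation K A A) : HH1 K A :=
  ⟨cls 0 (⟨_, LinearMap.mem_ker.2 (d_derivation D)⟩ : Cocycle K A 1), ⟨_, rfl⟩⟩

end Derivations

section GroupAlgebra

variable (K : Type*) {G : Type*} [Field K] [CommGroup G]

/-- The least `i` with `g ^ i = x`; this is the `i ∈ {0, …, |G| - 1}` with `x = g ^ i`, if `g`
generates the finite group `G`. -/
def expo (g x : G) : ℕ := sInf {i | g ^ i = x}

/-- `Q (x) = {y | x y < y}`, for the order `1 < g < g ^ 2 < ⋯ < g ^ (|G| - 1)`. -/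
def Q (g x : G) : Set G := {y | expo g (x * y) < expo g y}

/-- The condition `C (n)` on `(x 1, …, x n)`: `x i ∈ Q (x (i + 1))` for all odd `i` if `n` is even,
and for all even `i ≥ 2` if `n` is odd. (Here `x i` is the entry `x ⟨i - 1, _⟩`, so that
`j = i - 1` has the parity of `n`.) -/
def condC (g : G) (n : ℕ) (x : Fin n → G) : Prop :=
  ∀ (j : ℕ) (h : j + 1 < n), j % 2 = n % 2 → x ⟨j, by omega⟩ ∈ Q g (x ⟨j + 1, h⟩)

open Classical in
/-- The cochain `β ^ n : G ^ n → K`. -/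
def beta (g : G) (n : ℕ) (x : Fin n → G) : K :=
  if condC g n x then if h : Odd n then (expo g (x ⟨0, h.pos⟩) : K) else 1 else 0

variable {K} [Fintype G]

/-- The Hochschild cochain of `K G` that represents `α ⊗ x`, for a map `α : G ^ n → K` and `x ∈ G`:
on the basis, `(x 1, …, x n) ↦ α (x 1, …, x n) x 1 ⋯ x n x`. -/
def psi {n : ℕ} (α : (Fin n → G) → K) (x : G) : Coch K (MonoidAlgebra K G) n :=
  ∑ u : Fin n → G,
    ((MultilinearMap.mkPiAlgebra K (Fin n) K).compLinearMap fun i =>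
        Finsupp.lapply (u i) ∘ₗ (MonoidAlgebra.coeffLinearEquiv K).toLinearMap).smulRight
      (MonoidAlgebra.single ((∏ i, u i) * x) (α u))

theorem psi_single {n : ℕ} (α : (Fin n → G) → K) (x : G) (u : Fin n → G) :
    psi α x (fun i => MonoidAlgebra.single (u i) 1) =
      MonoidAlgebra.single ((∏ i, u i) * x) (α u) := by
  classical
  have h : ∀ v : Fin n → G, ∏ i, (Finsupp.single (u i) (1 : K)) (v i) = if v = u then 1 else 0 := by
    intro v
    split_ifs with hv
    · subst hv; simp
    · obtain ⟨i, hi⟩ := Function.ne_iff.1 hv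
      exact Finset.prod_eq_zero (Finset.mem_univ i) (Finsupp.single_eq_of_ne hi)
  have h' : psi α x (fun i => MonoidAlgebra.single (u i) 1) = ∑ v : Fin n → G,
      (∏ i, (Finsupp.single (u i) (1 : K)) (v i)) •
        MonoidAlgebra.single ((∏ i, v i) * x) (α v) := by
    simp [psi, MultilinearMap.smulRight]
  rw [h', Finset.sum_congr rfl fun v _ => by rw [h v, ite_smul, one_smul, zero_smul],
    Finset.sum_ite_eq' Finset.univ u]
  simp

end GroupAlgebra

end Hochschild

end

/-! For abelian `G`, record the coefficient of `f (u 1, …, u n)` at `u 1 ⋯ u n x`. This component at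
`x` turns the Hochschild differential of `K G` into the differential of cochains of `G` with trivial
coefficients (`comp_d`), so that `HH ^ n (K G)` is a sum of copies of `H ^ n (G, K)`, one for each
`x ∈ G`.

For cyclic `G`, `H ^ n (G, K)` with `n` odd is a quotient of a subspace of `K`, hence at most a line
(`exists_eq_smul_add_gdiff`). It is a line spanned by `β ^ (2 r + 1)`. Indeed `β ^ (2 r + 1)` is the
cup product of the homomorphism `expo : G → K`, which exists because `|G| = 0` in `K`, with `r`
copies of the carry cocycle, so it is a cocycle (`gdiff_beta`). Moreover the functional `phi`,
evaluation on the chain `∑_y [g | y 1 | g | ⋯ | y r | g]`, kills coboundaries (`phi_gdiff`) and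
takes the value `1` on it (`phi_beta`). Thus the classes of `β ^ (2 r + 1) ⊗ x` form a basis, and
`phi` of the components gives the coordinates of any class (`cls_eq_sum`).

Brackets are therefore computed by applying `phi` to Gerstenhaber products. Of the `2 r + 1`
insertions of `β ^ (2 s + 1) ⊗ z` into `β ^ (2 r + 1) ⊗ x`, the one at place `0` contributes `expo z
+ 1`. The others cancel in consecutive pairs (`sum_circTerm`), whatever `r` and `s` are.
Antisymmetrizing gives `(expo z - expo x)` times the class of `β ^ (2 (r + s) + 1) ⊗ x z`
(`lie_betaCls`). The structure constants do not depend on `r` and `s`, which is the current algebra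
structure; for `r = s = 0` they are those of the derivations `D i`. -/

noncomputable section

namespace Hochschild

/-! ### Cochains of `G` with trivial coefficients -/

section GroupCochains

variable {K G : Type*} [CommRing K] [CommGroup G]

/-- The differential of inhomogeneous cochains of `G` with trivial coefficients `K`. -/
def gdiff (n : ℕ) : ((Fin n → G) → K) →ₗ[K] ((Fin (n + 1) → G) → K) where
  toFun f x := f (Fin.tail x)
    + ∑ i : Fin n, (-1 : ℤ) ^ ((i : ℕ) + 1) • f (Fin.contractNth i.castSucc (· * ·) x)
    + (-1 : ℤ) ^ (n + 1) • f (Fin.init x)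
  map_add' f h := by
    funext x
    simp only [Pi.add_apply, smul_add, Finset.sum_add_distrib]
    abel
  map_smul' c f := by
    funext x
    simp only [Pi.smul_apply, RingHom.id_apply, smul_add, Finset.smul_sum, smul_comm _ c]

theorem gdiff_apply {n : ℕ} (f : (Fin n → G) → K) (x : Fin (n + 1) → G) :
    gdiff n f x = f (Fin.tail x)
      + ∑ i : Fin n, (-1 : ℤ) ^ ((i : ℕ) + 1) • f (Fin.contractNth i.castSucc (· * ·) x)
      + (-1 : ℤ) ^ (n + 1) • f (Fin.init x) := rfl

end GroupCochains

/-! ### Odd cohomology of a finite cyclic group is at most a line -/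

section Cyclic

universe u v

open CategoryTheory

theorem contractNth_last {n : ℕ} {M : Type*} (op : M → M → M) (x : Fin (n + 1) → M) :
    Fin.contractNth (Fin.last n) op x = Fin.init x := by
  funext k
  rw [Fin.contractNth_apply_of_lt _ _ _ _ (by simp)]
  rfl

theorem inhomogeneousCochains_d_trivial {K G : Type u} [CommRing K] [CommGroup G] (n : ℕ)
    (f : (Fin n → G) → K) :
    (inhomogeneousCochains.d (Rep.trivial K G K) n).hom f = gdiff n f := by
  funext x
  rw [gdiff_apply, inhomogeneousCochains.d_hom_apply, Fin.sum_univ_castSucc, contractNth_last]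
  simp only [Fin.val_castSucc, Fin.val_last, ← add_assoc, zsmul_eq_mul, Int.cast_pow, Int.cast_neg,
    Int.cast_one]
  rfl

/-- Cohomology is the cokernel of cochains → cocycles, so the sequence cochains → cocycles →
cohomology is exact at the cocycles. -/
theorem homologyπ_eq_zero {K G : Type u} [CommRing K] [Group G] (A : Rep K G) (m : ℕ)
    (f : (Fin (m + 1) → G) → A) (h : inhomogeneousCochains.d A (m + 1) f = 0)
    (h0 : groupCohomology.π A (m + 1) (groupCohomology.cocyclesMk f h) = 0) :
      ∃ v : (Fin m → G) → A, inhomogeneousCochains.d A m v = f := by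
  have hex : (ShortComplex.mk ((groupCohomology.inhomogeneousCochains A).toCycles m (m + 1))
      ((groupCohomology.inhomogeneousCochains A).homologyπ (m + 1)) (by simp)).Exact :=
    ShortComplex.exact_of_g_is_cokernel _
      ((groupCohomology.inhomogeneousCochains A).homologyIsCokernel m (m + 1) (by simp))
  obtain ⟨v, hv⟩ := (ShortComplex.moduleCat_exact_iff _).1 hex _ h0
  refine ⟨v, ?_⟩
  have := congrArg (groupCohomology.iCocycles A (m + 1)) hv
  rw [groupCohomology.iCocycles_mk] at this
  rw [← this, ← groupCohomology.inhomogeneousCochains.d_def,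
    ← (groupCohomology.inhomogeneousCochains A).toCycles_i m (m + 1)]
  rfl

/-- For cyclic `G`, odd cohomology is the image under `P` of a subspace of the coefficient module,
here `K` itself. Preimages of the classes of `b` and `f` are thus two scalars, and the one for `b`
is nonzero because `b` is not a coboundary; their quotient is `c`. -/
theorem exists_eq_smul_add_gdiff_of_same_universe {K G : Type u} [Field K] [CommGroup G]
    [Fintype G] (g : G)
    (hg : ∀ x : G, x ∈ Subgroup.zpowers g) (m : ℕ) (hm : Odd (m + 1))
    (b f : (Fin (m + 1) → G) → K) (hb : gdiff _ b = 0) (hf : gdiff _ f = 0)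
    (hb' : ∀ v, gdiff m v ≠ b) : ∃ (c : K) (v : (Fin m → G) → K), f = c • b + gdiff m v := by
  let A : Rep K G := Rep.trivial K G K
  let P := Rep.FiniteCyclicGroup.groupCohomologyπOdd A g hg (m + 1) hm
  have hP : Function.Surjective P := (ModuleCat.epi_iff_surjective _).1
    (epi_comp' (@IsIso.epi_of_iso _ _ _ _ _ (Iso.isIso_inv _)) (epi_comp _ _))
  have key : ∀ f : (Fin (m + 1) → G) → K, ∀ hf : gdiff _ f = 0,
      inhomogeneousCochains.d A (m + 1) f = 0 := fun f hf =>
    (inhomogeneousCochains_d_trivial (m + 1) f).trans hf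
  have hmk : ∀ c : K, groupCohomology.cocyclesMk (A := A) (f - c • b)
      (key _ (by rw [map_sub, map_smul, hf, hb, smul_zero, sub_zero])) =
      groupCohomology.cocyclesMk (A := A) f (key f hf) -
        c • groupCohomology.cocyclesMk (A := A) b (key b hb) := by
    intro c
    apply (ModuleCat.mono_iff_injective (groupCohomology.iCocycles A (m + 1))).1 inferInstance
    refine (groupCohomology.iCocycles_mk _ _).trans ?_
    refine Eq.trans ?_ (map_sub (groupCohomology.iCocycles A (m + 1)).hom _ _).symm
    refine congrArg₂ (· - ·) (groupCohomology.iCocycles_mk (A := A) _ _).symm ?_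
    refine Eq.trans ?_ (map_smul (groupCohomology.iCocycles A (m + 1)).hom _ _).symm
    exact congrArg (c • ·) (groupCohomology.iCocycles_mk (A := A) _ _).symm
  obtain ⟨a₁, h₁⟩ := hP (groupCohomology.π A (m + 1) (groupCohomology.cocyclesMk b (key b hb)))
  obtain ⟨a₂, h₂⟩ := hP (groupCohomology.π A (m + 1) (groupCohomology.cocyclesMk f (key f hf)))
  have hne : (a₁ : A) ≠ 0 := by
    intro h
    have h' : a₁ = 0 := Subtype.ext h
    rw [h', map_zero] at h₁
    obtain ⟨v, hv⟩ := homologyπ_eq_zero A m b (key b hb) h₁.symm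
    exact hb' v ((inhomogeneousCochains_d_trivial m v).symm.trans hv)
  let x₁ : K := (a₁ : A)
  let x₂ : K := (a₂ : A)
  have hx : x₁ ≠ 0 := hne
  have ha : a₂ = (x₂ / x₁) • a₁ := by
    apply Subtype.ext
    change x₂ = (x₂ / x₁) * x₁
    field_simp
  obtain ⟨v, hv⟩ := homologyπ_eq_zero A m (f - (x₂ / x₁) • b)
    (key _ (by rw [map_sub, map_smul, hf, hb, smul_zero, sub_zero])) (by
      rw [hmk, map_sub, map_smul, ← h₁, ← h₂, ha, map_smul, sub_self])
  refine ⟨x₂ / x₁, v, ?_⟩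
  have := (inhomogeneousCochains_d_trivial m v).symm.trans hv
  rw [this]
  exact (add_sub_cancel _ _).symm

/-- Two cocycles of odd degree of a finite cyclic group with coefficients in a field are
cohomologous up to a scalar, unless the second one is a coboundary. -/
theorem exists_eq_smul_add_gdiff {K : Type u} {G : Type v} [Field K] [CommGroup G] [Fintype G]
    (g : G) (hg : ∀ x : G, x ∈ Subgroup.zpowers g) (m : ℕ) (hm : Odd (m + 1))
    (b f : (Fin (m + 1) → G) → K) (hb : gdiff _ b = 0) (hf : gdiff _ f = 0)
    (hb' : ∀ v, gdiff m v ≠ b) : ∃ (c : K) (v : (Fin m → G) → K), f = c • b + gdiff m v := by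
  -- The previous theorem has `K` and `G` in one universe; cochains are carried to lifted copies of
  -- both and back, compatibly with `gdiff`.
  let up : ∀ n, ((Fin n → G) → K) → (Fin n → ULift.{u} G) → ULift.{v} K :=
    fun n f x => ULift.up (f fun i => (x i).down)
  let down : ∀ n, ((Fin n → ULift.{u} G) → ULift.{v} K) → (Fin n → G) → K :=
    fun n f x => (f fun i => ULift.up (x i)).down
  have hc : ∀ n (i : Fin n) (x : Fin (n + 1) → G),
      (fun k => ULift.up.{u} (Fin.contractNth i.castSucc (· * ·) x k)) =
        Fin.contractNth i.castSucc (· * ·) fun k => ULift.up (x k) := by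
    intro n i x
    funext k
    simp only [Fin.contractNth]
    split_ifs <;> rfl
  have hc' : ∀ n (i : Fin n) (x : Fin (n + 1) → ULift.{u} G),
      (fun k => (Fin.contractNth i.castSucc (· * ·) x k).down) =
        Fin.contractNth i.castSucc (· * ·) fun k => (x k).down := by
    intro n i x
    funext k
    simp only [Fin.contractNth]
    split_ifs <;> rfl
  let dn : ULift.{v} K →+ K := (ULift.ringEquiv : ULift.{v} K ≃+* K).toRingHom.toAddMonoidHom
  have hdown : ∀ n f, gdiff n (down n f) = down (n + 1) (gdiff n f) := by
    intro n f
    funext x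
    change _ = dn (gdiff n f fun i => ULift.up (x i))
    rw [gdiff_apply, gdiff_apply]
    simp only [map_add, map_sum, map_zsmul, ← hc]
    rfl
  have hup : ∀ n f, gdiff n (up n f) = up (n + 1) (gdiff n f) := by
    intro n f
    have h := hdown n (up n f)
    change gdiff n f = _ at h
    rw [h]
  obtain ⟨c, v, hv⟩ := exists_eq_smul_add_gdiff_of_same_universe (K := ULift.{v} K)
    (G := ULift.{u} G) (ULift.up g)
    (fun x => by
      obtain ⟨k, hk⟩ := Subgroup.mem_zpowers_iff.1 (hg x.down)
      exact Subgroup.mem_zpowers_iff.2 ⟨k, ULift.down_injective hk⟩)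
    m hm (up _ b) (up _ f) (by rw [hup, hb]; rfl) (by rw [hup, hf]; rfl)
    (fun v hv => hb' (down m v) (by rw [hdown, hv]))
  refine ⟨c.down, down m v, ?_⟩
  rw [hdown]
  exact congrArg (down (m + 1)) hv

end Cyclic

/-! ### The cycle that detects odd classes -/

section Sequences

variable {K G : Type*} [CommRing K] [CommGroup G]

theorem contractNth_eq_ins {n : ℕ} (U : ℕ → G) (i : Fin n) :
    Fin.contractNth i.castSucc (· * ·) (fun j : Fin (n + 1) => U j) =
      fun j : Fin n => ins i 2 (U i * U (i + 1)) U j := by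
  funext j
  simp only [Fin.contractNth, ins, Fin.val_castSucc]
  split_ifs with h1 h2
  · rfl
  · simp [h2]
  · rfl

theorem gdiff_seq {n : ℕ} (f : (Fin n → G) → K) (U : ℕ → G) :
    gdiff n f (fun j => U j) = f (fun j => shift 1 U j)
      + ∑ i ∈ Finset.range n,
          (-1 : ℤ) ^ (i + 1) • f (fun j => ins i 2 (U i * U (i + 1)) U j)
      + (-1 : ℤ) ^ (n + 1) • f (fun j => U j) := by
  rw [gdiff_apply, ← Fin.sum_univ_eq_sum_range (fun i =>
    (-1 : ℤ) ^ (i + 1) • f (fun j => ins i 2 (U i * U (i + 1)) U j)) n]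
  congr 2
  · congr 1
    funext j
    simp [Fin.tail, shift, add_comm]
  · refine Finset.sum_congr rfl fun i _ => ?_
    rw [contractNth_eq_ins]

/-- The sequence `g, y 0, g, y 1, …`. -/
def zig (g : G) (y : ℕ → G) : ℕ → G := fun k => if k % 2 = 0 then g else y (k / 2)

/-- The extension of a tuple to a sequence by a constant. -/
def extend {t : ℕ} (c : G) (y : Fin t → G) : ℕ → G := fun k => if h : k < t then y ⟨k, h⟩ else c

theorem extend_update {t : ℕ} (c : G) (y : Fin t → G) (k : Fin t) (v : G) :
    extend c (Function.update y k v) = Function.update (extend c y) k v := by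
  funext j
  by_cases h : j = k
  · subst h; simp [extend]
  · by_cases hj : j < t
    · have : (⟨j, hj⟩ : Fin t) ≠ k := fun e => h (by rw [← e])
      simp [extend, hj, Function.update_of_ne h, Function.update_of_ne this]
    · simp [extend, hj, Function.update_of_ne h]

variable [Fintype G]

/-- The functional `f ↦ ∑_y f (g, y 1, g, y 2, …, y t, g)` on cochains of degree `2 t + 1`. -/
def phi (g : G) (t : ℕ) : ((Fin (2 * t + 1) → G) → K) →ₗ[K] K where
  toFun f := ∑ y : Fin t → G, f (fun j => zig g (extend g⁻¹ y) j)
  map_add' f h := by simp [Finset.sum_add_distrib]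
  map_smul' c f := by simp [Finset.mul_sum]

theorem phi_apply (g : G) (t : ℕ) (f : (Fin (2 * t + 1) → G) → K) :
    phi g t f = ∑ y : Fin t → G, f (fun j => zig g (extend g⁻¹ y) j) := rfl

theorem sum_range_two_mul {M : Type*} [AddCommMonoid M] (r : ℕ) (F : ℕ → M) :
    ∑ i ∈ Finset.range (2 * r), F i = ∑ k ∈ Finset.range r, (F (2 * k) + F (2 * k + 1)) := by
  induction r with
  | zero => simp
  | succ r ih =>
    rw [show 2 * (r + 1) = 2 * r + 1 + 1 by ring, Finset.sum_range_succ, Finset.sum_range_succ, ih,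
      Finset.sum_range_succ, add_assoc]

theorem sum_mul_update {M : Type*} [AddCommMonoid M] {t : ℕ} (g : G) (k : Fin t)
    (F : (Fin t → G) → M) :
    ∑ y, F (Function.update y k (g * y k)) = ∑ y, F y := by
  refine Fintype.sum_equiv
    { toFun := fun y => Function.update y k (g * y k)
      invFun := fun y => Function.update y k (g⁻¹ * y k)
      left_inv := fun y => by simp
      right_inv := fun y => by simp } _ _ fun y => rfl

/-- The chain `∑_y [g | y 1 | g | ⋯ | y t | g]` is a cycle. Merging `y k` with the `g` on its left
or on its right gives, after the bijective substitution `y k ↦ g * y k`, the same tuple with that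
`g` left out. The faces then telescope. -/
theorem phi_gdiff (g : G) (t : ℕ) (u : (Fin (2 * t) → G) → K) : phi g t (gdiff (2 * t) u) = 0 := by
  -- `W k y` is `zig g y` without its `k`-th entry `g`, counted from `0`; the outer faces give `S 0`
  -- and `S t`.
  let W : ℕ → (ℕ → G) → ℕ → G := fun k y j => if j < 2 * k then zig g y j else zig g y (j + 1)
  let S : ℕ → K := fun k => ∑ y : Fin t → G, u (fun j => W k (extend g⁻¹ y) j)
  have h0 : ∑ y : Fin t → G, u (fun j => shift 1 (zig g (extend g⁻¹ y)) j) = S 0 := by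
    simp only [S, W, shift]
    simp [add_comm]
  have ht : ∑ y : Fin t → G, u (fun j => zig g (extend g⁻¹ y) j) = S t := by
    refine Finset.sum_congr rfl fun y _ => congrArg u (funext fun j => ?_)
    simp only [W, if_pos j.2]
  have he : ∀ k < t, ∑ y : Fin t → G, u (fun j => ins (2 * k) 2
      (zig g (extend g⁻¹ y) (2 * k) * zig g (extend g⁻¹ y) (2 * k + 1)) (zig g (extend g⁻¹ y)) j) = S k := by
    intro k hk
    refine Eq.trans ?_ (sum_mul_update g ⟨k, hk⟩ fun y => u fun j => W k (extend g⁻¹ y) j)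
    refine Finset.sum_congr rfl fun y _ => congrArg u (funext fun j => ?_)
    simp only [W, extend_update, zig, ins, Function.update_apply]
    have : extend g⁻¹ y k = y ⟨k, hk⟩ := by simp [extend, hk]
    clear_value S
    clear h0 ht
    grind
  have ho : ∀ k < t, ∑ y : Fin t → G, u (fun j => ins (2 * k + 1) 2
      (zig g (extend g⁻¹ y) (2 * k + 1) * zig g (extend g⁻¹ y) (2 * k + 1 + 1)) (zig g (extend g⁻¹ y)) j) =
      S (k + 1) := by
    intro k hk
    refine Eq.trans ?_ (sum_mul_update g ⟨k, hk⟩ fun y => u fun j => W (k + 1) (extend g⁻¹ y) j)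
    refine Finset.sum_congr rfl fun y _ => congrArg u (funext fun j => ?_)
    simp only [W, extend_update, zig, ins, Function.update_apply]
    have : extend g⁻¹ y k = y ⟨k, hk⟩ := by simp [extend, hk]
    have hc : extend g⁻¹ y k * g = g * y ⟨k, hk⟩ := by rw [this, mul_comm]
    clear_value S
    clear h0 ht he
    grind
  have hsum : ∑ k ∈ Finset.range t, (S (k + 1) - S k) = S t - S 0 := Finset.sum_range_sub S t
  rw [phi_apply]
  simp only [gdiff_seq, Finset.sum_add_distrib, h0]
  rw [Finset.sum_comm]
  simp only [← Finset.smul_sum]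
  rw [ht, sum_range_two_mul, sign_odd (by omega)]
  rw [Finset.sum_congr rfl fun k hk => show _ = S (k + 1) - S k by
    rw [he k (Finset.mem_range.1 hk), ho k (Finset.mem_range.1 hk), sign_odd (by omega),
      sign_even (by omega)]
    simp; ring]
  rw [hsum]
  simp

end Sequences

/-! ### Exponents and the carry cocycle -/

section Carry

variable {G : Type*} [CommGroup G] [Fintype G] (g : G) (hg : ∀ x : G, x ∈ Subgroup.zpowers g)

include hg

theorem pow_expo (x : G) : g ^ expo g x = x := by
  obtain ⟨k, hk⟩ := mem_powers_iff_mem_zpowers.2 (hg x)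
  exact Nat.sInf_mem (s := {i | g ^ i = x}) ⟨k, hk⟩

theorem expo_lt (x : G) : expo g x < Fintype.card G := by
  have hx := pow_expo g hg x
  -- The remainder is again an exponent of `x`, so minimality bounds `expo g x` by it.
  have h : expo g x ≤ expo g x % Fintype.card G :=
    Nat.sInf_le (s := {i | g ^ i = x}) (by
      change g ^ _ = x
      rw [pow_mod_card, hx])
  exact h.trans_lt (Nat.mod_lt _ Fintype.card_pos)

theorem orderOf_eq_card' : orderOf g = Fintype.card G := by
  rw [orderOf_eq_card_of_forall_mem_zpowers hg, Nat.card_eq_fintype_card]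

theorem expo_pow (i : ℕ) : expo g (g ^ i) = i % Fintype.card G := by
  have h := pow_expo g hg (g ^ i)
  rw [pow_inj_mod, orderOf_eq_card' g hg, Nat.mod_eq_of_lt (expo_lt g hg _)] at h
  exact h

theorem expo_mul (x y : G) : expo g (x * y) = (expo g x + expo g y) % Fintype.card G := by
  conv_lhs => rw [← pow_expo g hg x, ← pow_expo g hg y, ← pow_add, expo_pow g hg]

omit hg in
open Classical in
/-- The carry of the addition of exponents, with values in a ring. -/
def carry (K : Type*) [CommRing K] (g u v : G) : K :=
  if expo g (v * u) < expo g u then 1 else 0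

theorem carry_eq (K : Type*) [CommRing K] (u v : G) :
    carry K g u v = if Fintype.card G ≤ expo g u + expo g v then 1 else 0 := by
  have h : (expo g (v * u) < expo g u) ↔ Fintype.card G ≤ expo g u + expo g v := by
    rw [expo_mul g hg]
    have hu := expo_lt g hg u
    have hv := expo_lt g hg v
    rcases lt_or_ge (expo g v + expo g u) (Fintype.card G) with h | h
    · rw [Nat.mod_eq_of_lt h]; omega
    · rw [Nat.mod_eq_sub_mod h, Nat.mod_eq_of_lt (by omega)]; omega
  simp only [carry, h]

/-- Over `ℤ`, `|G|` times the carry is the coboundary of `expo`. This makes the cocycle identity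
automatic once `|G|` is cancelled. -/
theorem carry_int (u v : G) :
    (Fintype.card G : ℤ) * carry ℤ g u v = expo g u + expo g v - expo g (u * v) := by
  rw [carry_eq g hg, expo_mul g hg]
  have hu := expo_lt g hg u
  have hv := expo_lt g hg v
  split_ifs with h
  · rw [Nat.mod_eq_sub_mod h, Nat.mod_eq_of_lt (by omega)]; omega
  · rw [Nat.mod_eq_of_lt (by omega)]; omega

omit hg in
theorem carry_cast (K : Type*) [CommRing K] (u v : G) : ((carry ℤ g u v : ℤ) : K) = carry K g u v := by
  simp only [carry]
  split_ifs <;> simp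

/-- `|G|` may vanish in `K`, so the identity is proved over `ℤ`, where `|G|` cancels, and then
mapped to `K`. -/
theorem carry_cocycle (K : Type*) [CommRing K] (u v w : G) :
    carry K g (u * v) w - carry K g u (v * w) = carry K g v w - carry K g u v := by
  have h : carry ℤ g (u * v) w - carry ℤ g u (v * w) = carry ℤ g v w - carry ℤ g u v := by
    have hN : (Fintype.card G : ℤ) ≠ 0 := by exact_mod_cast Fintype.card_ne_zero
    apply mul_left_cancel₀ hN
    rw [mul_sub, mul_sub, carry_int g hg, carry_int g hg, carry_int g hg, carry_int g hg, mul_assoc]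
    ring
  have := congrArg (Int.cast : ℤ → K) h
  simpa only [Int.cast_sub, carry_cast] using this

variable {K : Type*} [CommRing K] (hN : (Fintype.card G : K) = 0)

include hN

/-- Exponents are only defined modulo `|G|`, which is `0` in `K`; hence `expo` becomes a
homomorphism from `G` to the additive group of `K`. -/
theorem expo_pow_cast (i : ℕ) : (expo g (g ^ i) : K) = i := by
  rw [expo_pow g hg]
  conv_rhs => rw [← Nat.mod_add_div i (Fintype.card G)]
  simp [hN]

theorem expo_mul_cast (x y : G) : (expo g (x * y) : K) = expo g x + expo g y := by
  conv_lhs => rw [← pow_expo g hg x, ← pow_expo g hg y, ← pow_add, expo_pow_cast g hg hN]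
  simp

theorem expo_inv_cast (x : G) : (expo g x⁻¹ : K) = -expo g x := by
  have h := expo_mul_cast g hg hN x⁻¹ x
  have h1 := expo_pow_cast g hg hN 0
  rw [pow_zero, Nat.cast_zero] at h1
  rw [inv_mul_cancel, h1] at h
  linear_combination -h

theorem expo_self_cast : (expo g g : K) = 1 := by
  have := expo_pow_cast g hg hN 1
  simpa using this

omit hN in
theorem sum_expo {M : Type*} [AddCommMonoid M] (F : ℕ → M) :
    ∑ v, F (expo g v) = ∑ i ∈ Finset.range (Fintype.card G), F i :=
  Finset.sum_nbij' (fun v => expo g v) (fun i => g ^ i)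
    (fun v _ => Finset.mem_range.2 (expo_lt g hg v)) (fun i _ => Finset.mem_univ _)
    (fun v _ => pow_expo g hg v)
    (fun i hi => by rw [expo_pow g hg, Nat.mod_eq_of_lt (Finset.mem_range.1 hi)])
    (fun v _ => rfl)

omit hN in
-- Adding `w` overflows exactly for the `expo g w` largest exponents of `v`.
theorem sum_carry (w : G) : ∑ v, carry K g v w = (expo g w : K) := by
  have hw := expo_lt g hg w
  simp only [carry_eq g hg]
  rw [sum_expo g hg fun i => if Fintype.card G ≤ i + expo g w then (1 : K) else 0,
    Finset.sum_boole]
  have h : ((Finset.range (Fintype.card G)).filter fun i => Fintype.card G ≤ i + expo g w) =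
      Finset.Ico (Fintype.card G - expo g w) (Fintype.card G) := by
    ext i
    simp only [Finset.mem_filter, Finset.mem_range, Finset.mem_Ico]
    omega
  rw [h, Nat.card_Ico, Nat.sub_sub_self hw.le]

/-- Adding `1` overflows only from the exponent `|G| - 1`. In the sums over `y` below, a carry
between `y k` and `g` therefore forces `y k = g⁻¹`. -/
theorem carry_self_right [Nontrivial K] [DecidableEq G] (v : G) :
    carry K g v g = if v = g⁻¹ then 1 else 0 := by
  -- In the trivial group `expo g g` would be `0`; it is excluded since `|G| = 0 ≠ 1` in `K`.
  have h1 : 1 < Fintype.card G := by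
    have h0 : 0 < Fintype.card G := Fintype.card_pos
    by_contra h
    have h' : Fintype.card G = 1 := by omega
    rw [h', Nat.cast_one] at hN
    exact one_ne_zero hN
  have he : expo g g = 1 := by
    have := expo_pow g hg 1
    rwa [pow_one, Nat.mod_eq_of_lt h1] at this
  rw [carry_eq g hg, he]
  have hv := expo_lt g hg v
  have h : Fintype.card G ≤ expo g v + 1 ↔ v = g⁻¹ := by
    constructor
    · intro h
      rw [eq_inv_iff_mul_eq_one]
      nth_rw 1 [← pow_expo g hg v]
      rw [← pow_succ, show expo g v + 1 = Fintype.card G by omega, pow_card_eq_one]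
    · intro h
      by_contra hlt
      have h2 := expo_mul g hg v g
      rw [he, Nat.mod_eq_of_lt (by omega), h, inv_mul_cancel] at h2
      have h3 := expo_pow g hg 0
      rw [pow_zero, Nat.zero_mod] at h3
      omega
  simp only [h]

theorem carry_self_left [Nontrivial K] [DecidableEq G] (v : G) :
    carry K g g v = if v = g⁻¹ then 1 else 0 := by
  rw [← carry_self_right g hg hN, carry_eq g hg, carry_eq g hg, add_comm]

end Carry

/-! ### The cochain `β` as a cup product -/

section BetaSeq

variable (K : Type*) {G : Type*} [Field K] [CommGroup G]

/-- The values of the cochain `β ^ (2 r + 1)` on sequences. -/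
def betaSeq (g : G) (r : ℕ) (U : ℕ → G) : K :=
  expo g (U 0) * ∏ k ∈ Finset.range r, carry K g (U (2 * k + 1)) (U (2 * k + 2))

theorem beta_seq (g : G) (r : ℕ) (U : ℕ → G) :
    beta K g (2 * r + 1) (fun j => U j) = betaSeq K g r U := by
  classical
  have h : condC g (2 * r + 1) (fun j => U j) ↔ ∀ k ∈ Finset.range r,
      expo g (U (2 * k + 2) * U (2 * k + 1)) < expo g (U (2 * k + 1)) := by
    constructor
    · intro h k hk
      have hk := Finset.mem_range.1 hk
      exact h (2 * k + 1) (by omega) (by omega)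
    · intro h j hj hj'
      obtain ⟨k, rfl⟩ : ∃ k, j = 2 * k + 1 := ⟨j / 2, by omega⟩
      exact h k (Finset.mem_range.2 (by omega))
  have hodd : Odd (2 * r + 1) := ⟨r, rfl⟩
  simp only [beta, betaSeq, carry, Finset.prod_ite_zero, h, dif_pos hodd, Finset.prod_const_one,
    mul_ite, mul_one, mul_zero]

theorem betaSeq_eq_zero (g : G) {r : ℕ} {U : ℕ → G} {k : ℕ} (hk : k < r)
    (h : carry K g (U (2 * k + 1)) (U (2 * k + 2)) = 0) : betaSeq K g r U = 0 := by
  rw [betaSeq, Finset.prod_eq_zero (Finset.mem_range.2 hk) h, mul_zero]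

/-- For the tuples that survive in the sums below, the inserted block consists of a head followed by
inverse pairs, so only its head enters the outer cochain. -/
theorem prod_eq_head {s : ℕ} (U : ℕ → G) (h : ∀ k < s, U (2 * k + 1) * U (2 * k + 2) = 1) :
    ∏ k ∈ Finset.range (2 * s + 1), U k = U 0 := by
  induction s with
  | zero => simp
  | succ s ih =>
    rw [show 2 * (s + 1) + 1 = 2 * s + 1 + 1 + 1 by ring, Finset.prod_range_succ,
      Finset.prod_range_succ, ih fun k hk => h k (by omega), mul_assoc, h s (by omega), mul_one]

variable [Fintype G] (g : G) (hg : ∀ x : G, x ∈ Subgroup.zpowers g)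
  (hN : (Fintype.card G : K) = 0)

-- A cup product of cocycles is a cocycle. Concretely, the faces inside the `k`-th carry combine by
-- `carry_cocycle` into a difference that telescopes, and additivity of `expo` disposes of the ends.
variable {K} in
include hg hN in
theorem gdiff_beta (r : ℕ) : gdiff (2 * r + 1) (beta K g (2 * r + 1)) = 0 := by
  funext x
  obtain ⟨U, rfl⟩ : ∃ U : ℕ → G, x = fun j : Fin (2 * r + 1 + 1) => U j :=
    ⟨extend 1 x, funext fun j => by rw [extend, dif_pos j.2]⟩
  rw [gdiff_seq]
  simp only [beta_seq K g r]
  -- The entry left unused by the carries moves along the tuple: the first `j` carries read `U 1, …,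
  -- U (2 j)`, the later ones are shifted one place to the right.
  let P : ℕ → K := fun j => ∏ k ∈ Finset.range r,
    if k < j then carry K g (U (2 * k + 1)) (U (2 * k + 2))
      else carry K g (U (2 * k + 2)) (U (2 * k + 3))
  have h0 : betaSeq K g r (shift 1 U) = expo g (U 1) * P 0 := by
    simp only [betaSeq, P, shift, Nat.not_lt_zero, if_false]
    congr 1
    exact Finset.prod_congr rfl fun k _ => by congr 2 <;> ring
  have h1 : betaSeq K g r (ins 0 2 (U 0 * U (0 + 1)) U) = (expo g (U 0) + expo g (U 1)) * P 0 := by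
    simp only [betaSeq, P, ins, Nat.not_lt_zero, if_false, if_true, Nat.add_eq_zero_iff,
      one_ne_zero, OfNat.ofNat_ne_zero, and_false, expo_mul_cast g hg hN]
    congr 1
  have hr : betaSeq K g r U = expo g (U 0) * P r := by
    simp only [betaSeq, P]
    congr 1
    exact Finset.prod_congr rfl fun k hk => by rw [if_pos (Finset.mem_range.1 hk)]
  have hk : ∀ k < r, betaSeq K g r (ins (2 * k + 1) 2 (U (2 * k + 1) * U (2 * k + 1 + 1)) U) -
      betaSeq K g r (ins (2 * k + 1 + 1) 2 (U (2 * k + 1 + 1) * U (2 * k + 1 + 1 + 1)) U) =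
      expo g (U 0) * (P k - P (k + 1)) := by
    intro k hk
    have hmem := Finset.mem_range.2 hk
    simp only [betaSeq, P]
    rw [← Finset.mul_prod_erase _ _ hmem, ← Finset.mul_prod_erase _ _ hmem,
      ← Finset.mul_prod_erase _ _ hmem, ← Finset.mul_prod_erase _ _ hmem]
    -- All factors other than the `k`-th agree in the four products.
    have e : ∀ F : ℕ → K, (∀ l ∈ (Finset.range r).erase k, F l = 
        if l < k then carry K g (U (2 * l + 1)) (U (2 * l + 2))
          else carry K g (U (2 * l + 2)) (U (2 * l + 3))) → 
        ∏ l ∈ (Finset.range r).erase k, F l = ∏ l ∈ (Finset.range r).erase k,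
          if l < k then carry K g (U (2 * l + 1)) (U (2 * l + 2))
            else carry K g (U (2 * l + 2)) (U (2 * l + 3)) :=
      fun F h => Finset.prod_congr rfl h
    rw [e (fun l => carry K g (ins (2 * k + 1) 2 _ U (2 * l + 1)) _),
      e (fun l => carry K g (ins (2 * k + 1 + 1) 2 _ U (2 * l + 1)) _),
      e (fun l => if l < k + 1 then _ else _)]
    · have := carry_cocycle g hg K (U (2 * k + 1)) (U (2 * k + 2)) (U (2 * k + 3))
      simp [ins]
      linear_combination (expo g (U 0) : K) * (∏ l ∈ (Finset.range r).erase k,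
          if l < k then carry K g (U (2 * l + 1)) (U (2 * l + 2))
            else carry K g (U (2 * l + 2)) (U (2 * l + 3))) * this
    all_goals
      intro l hl
      have hl := Finset.ne_of_mem_erase hl
      try simp only [ins]
      grind
  rw [Finset.sum_range_succ', sum_range_two_mul, h0, hr]
  rw [Finset.sum_congr rfl fun k hk' => show _ = expo g (U 0) * (P k - P (k + 1)) by
    rw [← hk k (Finset.mem_range.1 hk'), sign_even (a := 2 * k + 1 + 1) (by omega),
      sign_odd (a := 2 * k + 1 + 1 + 1) (by omega)]
    simp; ring]
  rw [← Finset.mul_sum, Finset.sum_range_sub', h1, sign_even (a := 2 * r + 1 + 1) (by omega)]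
  simp
  ring

end BetaSeq

/-! ### Values of `phi` on `β` and on its Gerstenhaber products -/

section PhiBeta

variable {K : Type*} {G : Type*} [Field K] [CommGroup G]

theorem zig_even (g : G) (Y : ℕ → G) (k : ℕ) : zig g Y (2 * k) = g := by simp [zig]

theorem zig_odd (g : G) (Y : ℕ → G) (k : ℕ) : zig g Y (2 * k + 1) = Y k := by
  simp only [zig]
  rw [if_neg (by omega)]
  congr 1
  omega

theorem extend_const {t : ℕ} (c : G) : extend c (fun _ : Fin t => c) = fun _ => c := by
  funext k
  simp [extend]

theorem extend_val {t : ℕ} (c : G) (y : Fin t → G) (k : Fin t) : extend c y k = y k := by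
  simp [extend]

variable [Fintype G]

/-- Used with `c = g⁻¹`: the carries pin every coordinate of `y` except the one next to the
insertion. -/
theorem sum_eq_sum_update {M : Type*} [AddCommMonoid M] {t : ℕ} (c : G) (k : Fin t)
    (F : (Fin t → G) → M) (h : ∀ y, ∀ j ≠ k, y j ≠ c → F y = 0) :
    ∑ y, F y = ∑ v, F (Function.update (fun _ => c) k v) := by
  classical
  rw [← Finset.sum_image (s := Finset.univ) (g := fun v => Function.update (fun _ => c) k v)
    (f := F) fun v _ w _ hvw => by simpa using congrFun hvw k]
  symm
  refine Finset.sum_subset (Finset.subset_univ _) fun y _ hy => ?_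
  by_contra hF
  refine hy (Finset.mem_image.2 ⟨y k, Finset.mem_univ _, ?_⟩)
  funext j
  by_cases hj : j = k
  · subst hj; simp
  · rw [Function.update_of_ne hj]
    by_contra hne
    exact hF (h y j hj (Ne.symm hne))

variable (g : G) (hg : ∀ x : G, x ∈ Subgroup.zpowers g) (hN : (Fintype.card G : K) = 0)

include hg hN

theorem betaSeq_zig (r : ℕ) : betaSeq K g r (zig g fun _ => g⁻¹) = 1 := by
  classical
  rw [betaSeq, Finset.prod_eq_one, mul_one, ← mul_zero 2, zig_even, expo_self_cast g hg hN]
  intro k _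
  rw [zig_odd, show 2 * k + 2 = 2 * (k + 1) by ring, zig_even, carry_self_right g hg hN,
    if_pos rfl]

/-- Every carry is between `y k` and `g`, so only the constant tuple `g⁻¹` contributes, with value
`expo g g = 1`. -/
theorem phi_beta (r : ℕ) : phi g r (beta K g (2 * r + 1)) = 1 := by
  classical
  rw [phi_apply]
  simp only [beta_seq K g r]
  rw [Fintype.sum_eq_single fun _ => g⁻¹, extend_const, betaSeq_zig g hg hN]
  intro y hy
  obtain ⟨k, hk⟩ := Function.ne_iff.1 hy
  refine betaSeq_eq_zero K g k.2 ?_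
  rw [zig_odd, show 2 * (k : ℕ) + 2 = 2 * (k + 1) by ring, zig_even, extend_val,
    carry_self_right g hg hN, if_neg hk]

omit [Fintype G] hg hN in
/-- The `q`-th term of the Gerstenhaber product of `β ^ (2 r + 1) ⊗ x` and `β ^ (2 s + 1) ⊗ z`. -/
def circTerm (K : Type*) [Field K] (g z : G) (r s q : ℕ) (U : ℕ → G) : K :=
  betaSeq K g s (shift q U) *
    betaSeq K g r (ins q (2 * s + 1) ((∏ k ∈ Finset.range (2 * s + 1), shift q U k) * z) U)

/-- All carries pair some `y k` with `g`, inside the block or after it, so `y` is constantly `g⁻¹`.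
The block then multiplies to `g`, and the outer cochain reads `g * z` as its head. -/
theorem sum_circTerm_zero (z : G) (r s t : ℕ) (ht : t = r + s) :
    ∑ y : Fin t → G, circTerm K g z r s 0 (zig g (extend g⁻¹ y)) = expo g (g * z) := by
  classical
  have hsh : ∀ U : ℕ → G, shift 0 U = U := fun U => by funext k; simp [shift]
  rw [Fintype.sum_eq_single fun _ => g⁻¹]
  · rw [extend_const, circTerm, hsh, betaSeq_zig g hg hN, one_mul, prod_eq_head]
    · rw [betaSeq, Finset.prod_eq_one, mul_one]
      · simp [ins, zig]
      · intro k _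
        simp only [ins]
        rw [if_neg (by omega), if_neg (by omega), if_neg (by omega), if_neg (by omega),
          show 2 * k + 1 + (2 * s + 1) - 1 = 2 * (k + s) + 1 by omega,
          show 2 * k + 2 + (2 * s + 1) - 1 = 2 * (k + s + 1) by omega, zig_odd, zig_even,
          carry_self_right g hg hN, if_pos rfl]
    · intro k _
      rw [zig_odd, show 2 * k + 2 = 2 * (k + 1) by ring, zig_even, inv_mul_cancel]
  · intro y hy
    obtain ⟨k, hk⟩ := Function.ne_iff.1 hy
    have hk0 : carry K g (zig g (extend g⁻¹ y) (2 * k + 1)) (zig g (extend g⁻¹ y) (2 * (k + 1)))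
        = 0 := by
      rw [zig_odd, zig_even, extend_val, carry_self_right g hg hN, if_neg hk]
    have hkt := k.2
    rw [circTerm, hsh]
    rcases lt_or_ge (k : ℕ) s with h | h
    · rw [betaSeq_eq_zero K g h hk0, zero_mul]
    · rw [mul_comm, betaSeq_eq_zero K g (k := k - s) (by omega), zero_mul]
      simp only [ins]
      rw [if_neg (by omega), if_neg (by omega), if_neg (by omega), if_neg (by omega)]
      convert hk0 using 3 <;> omega

/-- The block begins with `y q`, which the inner cochain reads as the factor `expo (y q)`. The other
coordinates are forced to be `g⁻¹`, the block multiplies to `y q`, and the outer carry between `y q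
* z` and `g` leaves only `y q = g⁻¹ * z⁻¹`. -/
theorem sum_circTerm_odd (z : G) (r s t q : ℕ) (ht : t = r + s) (hq : q < r) :
    ∑ y : Fin t → G, circTerm K g z r s (2 * q + 1) (zig g (extend g⁻¹ y)) = -expo g (g * z) := by
  classical
  rw [sum_eq_sum_update g⁻¹ ⟨q, by omega⟩]
  · have hF : ∀ v, circTerm K g z r s (2 * q + 1) (zig g (extend g⁻¹
        (Function.update (fun _ : Fin t => g⁻¹) ⟨q, by omega⟩ v))) =
        expo g v * if v = g⁻¹ * z⁻¹ then 1 else 0 := by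
      intro v
      rw [extend_update, extend_const]
      set Y : ℕ → G := Function.update (fun _ => g⁻¹) q v with hY
      have hYq : Y q = v := by simp [hY]
      have hYne : ∀ l, l ≠ q → Y l = g⁻¹ := fun l hl => by simp [hY, hl]
      rw [circTerm, prod_eq_head]
      · have h1 : betaSeq K g s (shift (2 * q + 1) (zig g Y)) = expo g v := by
          rw [betaSeq, Finset.prod_eq_one, mul_one]
          · rw [shift, add_zero, zig_odd, hYq]
          · intro l _
            simp only [shift]
            rw [show 2 * q + 1 + (2 * l + 1) = 2 * (q + l + 1) by ring, zig_even,
              show 2 * q + 1 + (2 * l + 2) = 2 * (q + l + 1) + 1 by ring, zig_odd,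
              hYne _ (by omega), carry_self_left g hg hN, if_pos rfl]
        rw [h1]
        congr 1
        have hv : v = g⁻¹ * z⁻¹ ↔ v * z = g⁻¹ := (eq_mul_inv_iff_mul_eq)
        simp only [hv]
        rw [betaSeq, Finset.prod_eq_single q]
        · simp only [ins, shift]
          rw [if_pos (by omega), if_neg (by omega), if_pos trivial, if_neg (by omega), if_neg (by omega),
            add_zero, zig_odd, hYq, show 2 * q + 2 + (2 * s + 1) - 1 = 2 * (q + s + 1) by omega,
            zig_even, ← mul_zero 2, zig_even, carry_self_right g hg hN, expo_self_cast g hg hN,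
            one_mul]
        · intro l hl hne
          simp only [ins]
          rcases lt_or_gt_of_ne hne with h | h
          · rw [if_pos (by omega), if_pos (by omega), zig_odd,
              show 2 * l + 2 = 2 * (l + 1) by ring, zig_even, hYne _ hne,
              carry_self_right g hg hN, if_pos rfl]
          · rw [if_neg (by omega), if_neg (by omega), if_neg (by omega), if_neg (by omega),
              show 2 * l + 1 + (2 * s + 1) - 1 = 2 * (l + s) + 1 by omega,
              show 2 * l + 2 + (2 * s + 1) - 1 = 2 * (l + s + 1) by omega, zig_odd, zig_even,
              hYne _ (by omega), carry_self_right g hg hN, if_pos rfl]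
        · intro h
          exact absurd (Finset.mem_range.2 hq) h
      · intro l _
        simp only [shift]
        rw [show 2 * q + 1 + (2 * l + 1) = 2 * (q + l + 1) by ring, zig_even,
          show 2 * q + 1 + (2 * l + 2) = 2 * (q + l + 1) + 1 by ring, zig_odd,
          hYne _ (by omega), mul_inv_cancel]
    simp only [hF, mul_ite, mul_one, mul_zero, Finset.sum_ite_eq', Finset.mem_univ, if_true]
    rw [← mul_inv, expo_inv_cast g hg hN]
  · intro y k hk hne
    have hkt := k.2
    have hk : (k : ℕ) ≠ q := fun h => hk (Fin.ext h)
    have hr : carry K g (zig g (extend g⁻¹ y) (2 * k + 1)) (zig g (extend g⁻¹ y) (2 * (k + 1)))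
        = 0 := by
      rw [zig_odd, zig_even, extend_val, carry_self_right g hg hN, if_neg hne]
    have hl : carry K g (zig g (extend g⁻¹ y) (2 * k)) (zig g (extend g⁻¹ y) (2 * k + 1))
        = 0 := by
      rw [zig_odd, zig_even, extend_val, carry_self_left g hg hN, if_neg hne]
    rw [circTerm]
    -- A coordinate `y k ≠ g⁻¹` kills the outer carry `k` if it lies before the block, the outer
    -- carry `k - s` if after it, and the inner carry `k - q - 1` if inside.
    rcases lt_or_ge (k : ℕ) q with h | h
    · rw [mul_comm, betaSeq_eq_zero K g (k := k) (by omega), zero_mul]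
      simp only [ins]
      rw [if_pos (by omega), if_pos (by omega)]
      exact hr
    rcases lt_or_ge (q + s) (k : ℕ) with h' | h'
    · rw [mul_comm, betaSeq_eq_zero K g (k := k - s) (by omega), zero_mul]
      simp only [ins]
      rw [if_neg (by omega), if_neg (by omega), if_neg (by omega), if_neg (by omega)]
      convert hr using 3 <;> omega
    · rw [betaSeq_eq_zero K g (k := k - q - 1) (by omega), zero_mul]
      simp only [shift]
      convert hl using 3 <;> omega

/-- The block now begins with `g` and multiplies to `g`, with inner value `1`. The coordinate `y q`
just before it is met only by the outer carry with `g * z`, and `sum_carry` evaluates the sum over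
it. -/
theorem sum_circTerm_even (z : G) (r s t q : ℕ) (ht : t = r + s) (hq : q < r) :
    ∑ y : Fin t → G, circTerm K g z r s (2 * q + 1 + 1) (zig g (extend g⁻¹ y)) =
      expo g (g * z) := by
  classical
  rw [sum_eq_sum_update g⁻¹ ⟨q, by omega⟩]
  · have hF : ∀ v, circTerm K g z r s (2 * q + 1 + 1) (zig g (extend g⁻¹
        (Function.update (fun _ : Fin t => g⁻¹) ⟨q, by omega⟩ v))) = carry K g v (g * z) := by
      intro v
      rw [extend_update, extend_const]
      set Y : ℕ → G := Function.update (fun _ => g⁻¹) q v with hY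
      have hYq : Y q = v := by simp [hY]
      have hYne : ∀ l, l ≠ q → Y l = g⁻¹ := fun l hl => by simp [hY, hl]
      rw [circTerm, prod_eq_head]
      · have h1 : betaSeq K g s (shift (2 * q + 1 + 1) (zig g Y)) = 1 := by
          rw [betaSeq, Finset.prod_eq_one, mul_one]
          · rw [shift, add_zero, show 2 * q + 1 + 1 = 2 * (q + 1) by ring, zig_even,
              expo_self_cast g hg hN]
          · intro l _
            simp only [shift]
            rw [show 2 * q + 1 + 1 + (2 * l + 1) = 2 * (q + l + 1) + 1 by ring, zig_odd,
              show 2 * q + 1 + 1 + (2 * l + 2) = 2 * (q + l + 2) by ring, zig_even,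
              hYne _ (by omega), carry_self_right g hg hN, if_pos rfl]
        rw [h1, one_mul]
        rw [betaSeq, Finset.prod_eq_single q]
        · simp only [ins, shift]
          rw [if_pos (by omega), if_pos (by omega), if_neg (by omega), if_pos trivial,
            add_zero, zig_odd, hYq, show 2 * q + 1 + 1 = 2 * (q + 1) by omega,
            zig_even, ← mul_zero 2, zig_even, expo_self_cast g hg hN, one_mul]
        · intro l hl hne
          simp only [ins]
          rcases lt_or_gt_of_ne hne with h | h
          · rw [if_pos (by omega), if_pos (by omega), zig_odd,
              show 2 * l + 2 = 2 * (l + 1) by ring, zig_even, hYne _ hne,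
              carry_self_right g hg hN, if_pos rfl]
          · rw [if_neg (by omega), if_neg (by omega), if_neg (by omega), if_neg (by omega),
              show 2 * l + 1 + (2 * s + 1) - 1 = 2 * (l + s) + 1 by omega,
              show 2 * l + 2 + (2 * s + 1) - 1 = 2 * (l + s + 1) by omega, zig_odd, zig_even,
              hYne _ (by omega), carry_self_right g hg hN, if_pos rfl]
        · intro h
          exact absurd (Finset.mem_range.2 hq) h
      · intro l _
        simp only [shift]
        rw [show 2 * q + 1 + 1 + (2 * l + 1) = 2 * (q + l + 1) + 1 by ring, zig_odd,
          show 2 * q + 1 + 1 + (2 * l + 2) = 2 * (q + l + 2) by ring, zig_even,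
          hYne _ (by omega), inv_mul_cancel]
    simp only [hF]
    exact sum_carry g hg _
  · intro y k hk hne
    have hkt := k.2
    have hk : (k : ℕ) ≠ q := fun h => hk (Fin.ext h)
    have hr : carry K g (zig g (extend g⁻¹ y) (2 * k + 1)) (zig g (extend g⁻¹ y) (2 * (k + 1)))
        = 0 := by
      rw [zig_odd, zig_even, extend_val, carry_self_right g hg hN, if_neg hne]
    rw [circTerm]
    rcases lt_or_ge (k : ℕ) q with h | h
    · rw [mul_comm, betaSeq_eq_zero K g (k := k) (by omega), zero_mul]
      simp only [ins]
      rw [if_pos (by omega), if_pos (by omega)]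
      exact hr
    rcases lt_or_ge (q + s) (k : ℕ) with h' | h'
    · rw [mul_comm, betaSeq_eq_zero K g (k := k - s) (by omega), zero_mul]
      simp only [ins]
      rw [if_neg (by omega), if_neg (by omega), if_neg (by omega), if_neg (by omega)]
      convert hr using 3 <;> omega
    · rw [betaSeq_eq_zero K g (k := k - q - 1) (by omega), zero_mul]
      simp only [shift]
      convert hr using 3 <;> omega

/-- The insertions at places `2 q + 1` and `2 q + 2` cancel; only place `0` is left. -/
theorem sum_circTerm (z : G) (r s t : ℕ) (ht : t = r + s) :
    ∑ y : Fin t → G, ∑ q ∈ Finset.range (2 * r + 1),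
      circTerm K g z r s q (zig g (extend g⁻¹ y)) = expo g z + 1 := by
  rw [Finset.sum_comm, Finset.sum_range_succ', sum_range_two_mul, Finset.sum_eq_zero, zero_add,
    sum_circTerm_zero g hg hN z r s t ht, expo_mul_cast g hg hN, expo_self_cast g hg hN, add_comm]
  intro q hq
  have hq := Finset.mem_range.1 hq
  rw [sum_circTerm_odd g hg hN z r s t q ht hq, sum_circTerm_even g hg hN z r s t q ht hq,
    neg_add_cancel]

end PhiBeta

/-! ### Decomposition of Hochschild cochains of `K G` by elements of `G` -/

section Components

variable {K : Type*} {G : Type*} [Field K] [CommGroup G]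

/-- The component at `x` of a Hochschild cochain of `K G`, a cochain `G ^ n → K`. -/
def comp (n : ℕ) (x : G) : Coch K (MonoidAlgebra K G) n →ₗ[K] ((Fin n → G) → K) where
  toFun f u := (f fun i => MonoidAlgebra.single (u i) 1).coeff ((∏ i, u i) * x)
  map_add' f h := by funext u; simp
  map_smul' c f := by funext u; simp

theorem comp_apply {n : ℕ} (x : G) (f : Coch K (MonoidAlgebra K G) n) (u : Fin n → G) :
    comp n x f u = (f fun i => MonoidAlgebra.single (u i) 1).coeff ((∏ i, u i) * x) := rfl

theorem coch_ext {n : ℕ} {f f' : Coch K (MonoidAlgebra K G) n}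
    (h : ∀ u : Fin n → G, (f fun i => MonoidAlgebra.single (u i) 1) =
      f' fun i => MonoidAlgebra.single (u i) 1) : f = f' := by
  refine Module.Basis.ext_multilinear (fun _ => MonoidAlgebra.basis G K) fun v => ?_
  simpa using h v

theorem comp_ext {n : ℕ} {f f' : Coch K (MonoidAlgebra K G) n}
    (h : ∀ x, comp n x f = comp n x f') : f = f' := by
  refine coch_ext fun u => ?_
  ext y
  have := congrFun (h ((∏ i, u i)⁻¹ * y)) u
  simpa only [comp_apply, mul_inv_cancel_left] using this

/-- An insertion preserves the total product up to `z`. With `m = 2` and `z = 1` this makes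
components compatible with the differential; in general it makes the Gerstenhaber product multiply
the labels `x` and `z`. -/
theorem prod_ins {M : Type*} [CommMonoid M] {n m N i : ℕ} (h : n + m = N + 1) (hi : i < n)
    (z : M) (U : ℕ → M) :
    ∏ j ∈ Finset.range n, ins i m ((∏ k ∈ Finset.range m, shift i U k) * z) U j =
      (∏ j ∈ Finset.range N, U j) * z := by
  obtain ⟨l, rfl⟩ : ∃ l, n = i + 1 + l := ⟨n - (i + 1), by omega⟩
  obtain rfl : N = i + m + l := by omega
  rw [Finset.prod_range_add, Finset.prod_range_succ, Finset.prod_range_add, Finset.prod_range_add]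
  have e1 : ∏ j ∈ Finset.range i, ins i m ((∏ k ∈ Finset.range m, shift i U k) * z) U j =
      ∏ j ∈ Finset.range i, U j :=
    Finset.prod_congr rfl fun j hj => if_pos (Finset.mem_range.1 hj)
  have e2 : ∏ j ∈ Finset.range l, ins i m ((∏ k ∈ Finset.range m, shift i U k) * z) U (i + 1 + j) =
      ∏ j ∈ Finset.range l, U (i + m + j) := by
    refine Finset.prod_congr rfl fun j _ => ?_
    simp only [ins]
    rw [if_neg (by omega), if_neg (by omega)]
    congr 1
    omega
  have e3 : ins i m ((∏ k ∈ Finset.range m, shift i U k) * z) U i =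
      (∏ k ∈ Finset.range m, U (i + k)) * z := by simp [ins, shift]
  rw [e1, e2, e3]
  simp only [mul_assoc, mul_comm z]

/-- Multiplying a value by `u 0` on the left or by the last entry on the right shifts its support by
the very factor by which the product of the arguments changes; commutativity of `G` is needed for
the right side. Hence the action on coefficients is trivial. -/
theorem comp_d {n : ℕ} (x : G) (f : Coch K (MonoidAlgebra K G) n) :
    comp (n + 1) x (d n f) = gdiff n (comp n x f) := by
  funext u
  have h : d n f (fun i => MonoidAlgebra.single (u i) 1) =
      MonoidAlgebra.single (u 0) 1 * f (Fin.tail fun i => MonoidAlgebra.single (u i) 1)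
          + ∑ i : Fin n, (-1 : ℤ) ^ ((i : ℕ) + 1) • f (Fin.contractNth i.castSucc (· * ·)
            fun i => MonoidAlgebra.single (u i) 1)
          + (-1 : ℤ) ^ (n + 1) • (f (Fin.init fun i => MonoidAlgebra.single (u i) 1) *
            MonoidAlgebra.single (u (Fin.last n)) 1) := rfl
  have hc : ∀ i : Fin n, (Fin.contractNth i.castSucc (· * ·)
      fun i => MonoidAlgebra.single (u i) (1 : K)) =
      fun k => MonoidAlgebra.single (Fin.contractNth i.castSucc (· * ·) u k) 1 := by
    intro i
    funext k
    simp only [Fin.contractNth]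
    split_ifs <;> simp
  have hp : ∀ i : Fin n, ∏ k, Fin.contractNth i.castSucc (· * ·) u k = ∏ k, u k := by
    intro i
    obtain ⟨U, rfl⟩ : ∃ U : ℕ → G, u = fun j : Fin (n + 1) => U j :=
      ⟨extend 1 u, funext fun j => by rw [extend, dif_pos j.2]⟩
    have := prod_ins (show n + 2 = (n + 1) + 1 by omega) i.2 1 U
    have e : ∏ k ∈ Finset.range 2, shift i U k = U i * U (i + 1) := by
      simp [Finset.prod_range_succ, shift]
    rw [e, mul_one, mul_one, Finset.prod_range, Finset.prod_range] at this
    rw [contractNth_eq_ins]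
    exact this
  rw [comp_apply, h, gdiff_apply]
  simp only [comp_apply, hc, hp]
  have coeff_zsmul : ∀ (c : ℤ) (y : MonoidAlgebra K G) (w : G), (c • y).coeff w = c • y.coeff w :=
    fun c y w =>
    map_zsmul ((Finsupp.applyAddHom w).comp
      (MonoidAlgebra.coeffLinearEquiv K).toLinearMap.toAddMonoidHom) c y
  simp only [MonoidAlgebra.coeff_add, MonoidAlgebra.coeff_sum, Finsupp.add_apply,
    Finsupp.finsetSum_apply, coeff_zsmul, MonoidAlgebra.coeff_single_mul_apply,
    MonoidAlgebra.coeff_mul_single_apply, one_mul, mul_one]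
  congr 1
  · congr 1
    rw [Fin.prod_univ_succ, mul_assoc, inv_mul_cancel_left]
    rfl
  · rw [Fin.prod_univ_castSucc, mul_right_comm, mul_inv_cancel_right]
    rfl

variable [Fintype G]

theorem comp_psi [DecidableEq G] {n : ℕ} (α : (Fin n → G) → K) (x y : G) :
    comp n x (psi α y) = if y = x then α else 0 := by
  funext u
  rw [comp_apply, psi_single, MonoidAlgebra.coeff_single, Finsupp.single_apply]
  simp only [mul_right_inj]
  split_ifs <;> rfl

theorem psi_linear_ext {n : ℕ} (f : Coch K (MonoidAlgebra K G) n) :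
    f = ∑ x : G, psi (comp n x f) x := by
  classical
  refine comp_ext fun x => ?_
  simp [comp_psi]

theorem d_psi {n : ℕ} (α : (Fin n → G) → K) (x : G) : d n (psi α x) = psi (gdiff n α) x := by
  classical
  refine comp_ext fun y => ?_
  rw [comp_d, comp_psi, comp_psi]
  split_ifs <;> simp

theorem psi_add {n : ℕ} (α α' : (Fin n → G) → K) (x : G) :
    psi (α + α') x = psi α x + psi α' x := by
  classical
  refine comp_ext fun y => ?_
  rw [map_add, comp_psi, comp_psi, comp_psi]
  split_ifs <;> simp

theorem psi_smul {n : ℕ} (c : K) (α : (Fin n → G) → K) (x : G) :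
    psi (c • α) x = c • psi α x := by
  classical
  refine comp_ext fun y => ?_
  rw [map_smul, comp_psi, comp_psi]
  split_ifs <;> simp

theorem circ_psi_beta (g x z : G) {r s t : ℕ} (h : (2 * r + 1) + (2 * s + 1) = (2 * t + 1) + 1)
    (U : ℕ → G) :
    (circ h (psi (beta K g (2 * r + 1)) x) (psi (beta K g (2 * s + 1)) z)).ev
      (fun k => MonoidAlgebra.single (U k) 1) =
    MonoidAlgebra.single ((∏ j : Fin (2 * t + 1), U j) * (x * z))
      (∑ q ∈ Finset.range (2 * r + 1), circTerm K g z r s q U) := by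
  have hpsi : ∀ (r : ℕ) (x : G) (U : ℕ → G),
      (psi (beta K g (2 * r + 1)) x).ev (fun k => MonoidAlgebra.single (U k) 1) =
      betaSeq K g r U • MonoidAlgebra.single ((∏ k ∈ Finset.range (2 * r + 1), U k) * x) 1 := by
    intro r x U
    rw [Coch.ev, psi_single (beta K g (2 * r + 1)) x fun j => U j, beta_seq K g r U,
      Finset.prod_range, MonoidAlgebra.smul_single, smul_eq_mul, mul_one]
  rw [ev_circ]
  have hq : ∀ q ∈ Finset.range (2 * r + 1), (-1 : ℤ) ^ (q * (2 * s + 1 + 1)) •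
      (psi (beta K g (2 * r + 1)) x).ev (ins q (2 * s + 1) ((psi (beta K g (2 * s + 1)) z).ev
        (shift q fun k => MonoidAlgebra.single (U k) 1)) fun k => MonoidAlgebra.single (U k) 1) =
      MonoidAlgebra.single ((∏ j : Fin (2 * t + 1), U j) * (x * z)) (circTerm K g z r s q U) := by
    intro q hq
    have hq := Finset.mem_range.1 hq
    -- The inserted cochain has odd degree, so every insertion has sign `+`.
    rw [sign_even (by rw [Nat.mul_mod, show (2 * s + 1 + 1) % 2 = 0 by omega]; simp), one_smul]
    have e1 : (shift q fun k => MonoidAlgebra.single (U k) (1 : K)) =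
      fun k => MonoidAlgebra.single (shift q U k) 1 := rfl
    rw [e1, hpsi, ev_ins_smul _ _ _ hq]
    have e2 : ∀ a : G, (ins q (2 * s + 1) (MonoidAlgebra.single a (1 : K))
        fun k => MonoidAlgebra.single (U k) 1) =
        fun k => MonoidAlgebra.single (ins q (2 * s + 1) a U k) 1 := by
      intro a
      funext k
      simp only [ins]
      split_ifs <;> rfl
    rw [e2, hpsi, prod_ins h hq, smul_smul, MonoidAlgebra.smul_single, smul_eq_mul, mul_one,
      circTerm, Finset.prod_range, mul_assoc, mul_comm z]
  rw [Finset.sum_congr rfl hq]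
  exact (map_sum (MonoidAlgebra.singleAddHom _) _ _).symm

end Components

/-! ### Vanishing, functionals and spanning in `HH ^ odd` -/

section Classes

variable {K A : Type*} [CommRing K] [Ring A] [Algebra K A]

theorem cls_eq_zero {r : ℕ} {f : Cocycle K A (2 * r + 1)} {v : Coch K A (2 * r)}
    (h : d (2 * r) v = f) : cls r f = 0 := by
  refine (LieSubmodule.Quotient.mk_eq_zero' (N := oddCoboundaries K A)).2 fun s => ?_
  change ∃ h, d (2 * s) h = coord s (single r (f : Coch K A (2 * r + 1)))
  by_cases hs : r = s
  · subst hs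
    exact ⟨v, by rw [coord_single_same]; exact h⟩
  · exact ⟨0, by rw [coord_single_ne hs, map_zero]⟩

/-- A functional on odd cocycles that vanishes on coboundaries, on `HH ^ odd`. -/
def descend (φ : OddCoch K A →ₗ[K] K)
    (h : ∀ F ∈ oddCoboundaries K A, φ (F : OddCoch K A) = 0) : HHodd K A →ₗ[K] K :=
  (oddCoboundaries K A).toSubmodule.liftQ (φ ∘ₗ (oddCocycles K A).toSubmodule.subtype) h

theorem span_eq_top_of_cls_mem {S : Submodule K (HHodd K A)}
    (h : ∀ r (f : Cocycle K A (2 * r + 1)), cls r f ∈ S) : S = ⊤ := by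
  rw [eq_top_iff]
  rintro x -
  obtain ⟨⟨F, hF⟩, rfl⟩ := LieSubmodule.Quotient.surjective_mk' (oddCoboundaries K A) x
  classical
  have e : (⟨F, hF⟩ : oddCocycles K A) =
      ∑ r ∈ DFinsupp.support (show ⨁ r : ℕ, Coch K A (2 * r + 1) from F),
        toOddCocycles r ⟨coord r F, LinearMap.mem_ker.2 (hF r)⟩ := by
    apply Subtype.ext
    rw [AddSubmonoidClass.coe_finsetSum]
    exact (DirectSum.sum_support_of (β := fun r => Coch K A (2 * r + 1)) F).symm
  rw [e, map_sum]
  exact Submodule.sum_mem _ fun r _ => h r _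

end Classes

/-! ### The basis of classes of `β ⊗ x` and its brackets -/

section Beta

universe u v

variable {K : Type u} {G : Type v} [Field K] [CommGroup G] [Fintype G]
variable (g : G) (hg : ∀ x : G, x ∈ Subgroup.zpowers g) (hN : (Fintype.card G : K) = 0)

include hg hN in
theorem psi_beta_mem (r : ℕ) (x : G) :
    psi (beta K g (2 * r + 1)) x ∈ Cocycle.{u, max u v} K (MonoidAlgebra K G) (2 * r + 1) := by
  classical
  rw [LinearMap.mem_ker, d_psi, gdiff_beta g hg hN]
  refine comp_ext fun y => ?_
  rw [comp_psi, map_zero, ite_self]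

/-- The cocycle `β ^ (2 r + 1) ⊗ x`. -/
def betaCocycle (r : ℕ) (x : G) : Cocycle.{u, max u v} K (MonoidAlgebra K G) (2 * r + 1) :=
  ⟨_, psi_beta_mem g hg hN r x⟩

/-- The class of `β ^ (2 r + 1) ⊗ x`. -/
def betaCls (r : ℕ) (x : G) : HHodd.{u, max u v} K (MonoidAlgebra K G) := cls r (betaCocycle g hg hN r x)

/-- The coefficient of the class of `β ^ (2 r + 1) ⊗ x`. -/
def betaCoeff (r : ℕ) (x : G) : HHodd.{u, max u v} K (MonoidAlgebra K G) →ₗ[K] K :=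
  descend (phi g r ∘ₗ comp (2 * r + 1) x ∘ₗ coord r) fun F hF => by
    obtain ⟨v, hv⟩ := hF r
    change phi g r (comp (2 * r + 1) x (coord r _)) = 0
    rw [← hv, comp_d, phi_gdiff]

theorem betaCoeff_betaCls [DecidableEq G] (r s : ℕ) (x y : G) :
    betaCoeff g r x (betaCls g hg hN s y) = if (s, y) = (r, x) then 1 else 0 := by
  change phi g r (comp (2 * r + 1) x (coord r (single s (psi (beta K g (2 * s + 1)) y)))) = _
  by_cases h : s = r
  · subst h
    rw [coord_single_same, comp_psi]
    by_cases hxy : y = x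
    · simp [hxy, phi_beta g hg hN]
    · simp [hxy]
  · rw [coord_single_ne h, map_zero, map_zero, if_neg fun e => h (congrArg Prod.fst e)]

/-- Each component of `f` is a multiple of `β` up to a coboundary, and the multiple is read off by
`phi`. Reassembling the components with `psi` turns these coboundaries into a single Hochschild
coboundary. -/
theorem cls_eq_sum (r : ℕ) (f : Cocycle.{u, max u v} K (MonoidAlgebra K G) (2 * r + 1)) :
    cls r f = ∑ x : G, phi g r (comp (2 * r + 1) x (f : Coch.{u, max u v} K (MonoidAlgebra K G) (2 * r + 1))) •
      betaCls g hg hN r x := by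
  classical
  have hβ : ∀ v, gdiff (2 * r) v ≠ beta K g (2 * r + 1) := fun v hv => by
    have := phi_beta g hg hN r
    rw [← hv, phi_gdiff] at this
    exact zero_ne_one this
  have hx : ∀ x : G, ∃ v : (Fin (2 * r) → G) → K,
      comp (2 * r + 1) x (f : Coch.{u, max u v} K (MonoidAlgebra K G) (2 * r + 1)) =
      phi g r (comp (2 * r + 1) x (f : Coch.{u, max u v} K (MonoidAlgebra K G) (2 * r + 1))) •
        beta K g (2 * r + 1) + gdiff (2 * r) v := by
    intro x
    obtain ⟨c, v, hv⟩ := exists_eq_smul_add_gdiff g hg (2 * r) ⟨r, rfl⟩ (beta K g (2 * r + 1))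
      (comp (2 * r + 1) x (f : Coch.{u, max u v} K (MonoidAlgebra K G) (2 * r + 1))) (gdiff_beta g hg hN r)
      (by rw [← comp_d, Cocycle.d_eq_zero, map_zero]) hβ
    refine ⟨v, ?_⟩
    -- `phi` kills the coboundary and is `1` on `β`, so it identifies the unknown scalar `c`.
    have hc := congrArg (phi g r) hv
    rw [map_add, map_smul, phi_gdiff, phi_beta g hg hN, smul_eq_mul, mul_one, add_zero] at hc
    rw [hc]
    exact hv
  choose v hv using hx
  rw [← sub_eq_zero]
  simp only [betaCls, ← map_smul, ← map_sum, ← map_sub]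
  refine cls_eq_zero (v := ∑ x, psi (v x) x) ?_
  have hf := psi_linear_ext (f : Coch.{u, max u v} K (MonoidAlgebra K G) (2 * r + 1))
  have hs : ∀ x, psi (comp (2 * r + 1) x (f : Coch.{u, max u v} K (MonoidAlgebra K G) (2 * r + 1))) x =
      phi g r (comp (2 * r + 1) x (f : Coch.{u, max u v} K (MonoidAlgebra K G) (2 * r + 1))) •
        psi (beta K g (2 * r + 1)) x + d (2 * r) (psi (v x) x) := by
    intro x
    conv_lhs => rw [hv x]
    rw [psi_add, psi_smul, d_psi]
  rw [Finset.sum_congr rfl fun x _ => hs x, Finset.sum_add_distrib, ← map_sum] at hf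
  rw [AddSubgroupClass.coe_sub, AddSubmonoidClass.coe_finsetSum]
  exact eq_sub_of_add_eq' (Eq.trans rfl hf.symm)

theorem lie_betaCls_eq_cls (r s : ℕ) (x z : G) :
    ⁅betaCls g hg hN r x, betaCls g hg hN s z⁆ =
      cls (r + s) (gerstCocycle r s (betaCocycle g hg hN r x) (betaCocycle g hg hN s z)) := by
  have h : ∀ r x, betaCls g hg hN r x = cls r (betaCocycle g hg hN r x) := fun _ _ => rfl
  rw [h, h]
  exact lie_cls _ _ _ _

include hg hN in
theorem phi_comp_circ [DecidableEq G] (x z w : G) {r s t : ℕ}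
    (h : (2 * r + 1) + (2 * s + 1) = (2 * t + 1) + 1) :
    phi g t (comp (2 * t + 1) w
      (circ h (psi (beta K g (2 * r + 1)) x) (psi (beta K g (2 * s + 1)) z))) =
    if x * z = w then (expo g z : K) + 1 else 0 := by
  have hy : ∀ U : ℕ → G, comp (2 * t + 1) w
      (circ h (psi (beta K g (2 * r + 1)) x) (psi (beta K g (2 * s + 1)) z)) (fun j => U j) =
      if x * z = w then ∑ q ∈ Finset.range (2 * r + 1), circTerm K g z r s q U else 0 := by
    intro U
    have := circ_psi_beta (K := K) g x z h U
    rw [Coch.ev] at this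
    rw [comp_apply, this, MonoidAlgebra.coeff_single, Finsupp.single_apply]
    simp only [mul_right_inj]
  rw [phi_apply]
  simp only [hy]
  split_ifs
  · exact sum_circTerm g hg hN z r s t (by omega)
  · simp

/-- By `cls_eq_sum` it suffices to apply `phi` to the components of the bracket. The two products
give `expo z + 1` and `expo x + 1` at `x * z`, and the constants cancel. -/
theorem lie_betaCls (r s : ℕ) (x z : G) :
    ⁅betaCls g hg hN r x, betaCls g hg hN s z⁆ =
      ((expo g z : K) - expo g x) • betaCls g hg hN (r + s) (x * z) := by
  classical
  have hw : ∀ w : G, phi g (r + s) (comp (2 * (r + s) + 1) w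
      (gerstCocycle r s (betaCocycle g hg hN r x) (betaCocycle g hg hN s z) :
        Coch.{u, max u v} K (MonoidAlgebra K G) (2 * (r + s) + 1))) =
      if x * z = w then (expo g z : K) - expo g x else 0 := by
    intro w
    have h : (gerstCocycle r s (betaCocycle g hg hN r x) (betaCocycle g hg hN s z) :
        Coch.{u, max u v} K (MonoidAlgebra K G) (2 * (r + s) + 1)) =
        gerst (odd_add r s) (psi (beta K g (2 * r + 1)) x) (psi (beta K g (2 * s + 1)) z) := rfl
    rw [h, gerst_odd _ (by omega), map_sub, map_sub, phi_comp_circ g hg hN,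
      phi_comp_circ g hg hN, mul_comm z x]
    split_ifs <;> ring
  rw [lie_betaCls_eq_cls, cls_eq_sum g hg hN]
  simp only [hw, ite_smul, zero_smul, Finset.sum_ite_eq, Finset.mem_univ, if_true]

theorem linearIndependent_betaCls :
    LinearIndependent K fun i : ℕ × G => betaCls g hg hN i.1 i.2 := by
  classical
  rw [linearIndependent_iff']
  intro s c hc i hi
  have := congrArg (betaCoeff g i.1 i.2) hc
  simpa [betaCoeff_betaCls, hi] using this

theorem span_betaCls :
    ⊤ ≤ Submodule.span K (Set.range fun i : ℕ × G => betaCls g hg hN i.1 i.2) := by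
  rw [top_le_iff]
  refine span_eq_top_of_cls_mem fun r f => ?_
  rw [cls_eq_sum g hg hN]
  exact Submodule.sum_mem _ fun x _ => Submodule.smul_mem _ _ (Submodule.subset_span ⟨(r, x), rfl⟩)

/-- The classes of `β ^ (2 r + 1) ⊗ x` form a basis of `HH ^ odd (K G)`. -/
def betaBasis : Module.Basis (ℕ × G) K (HHodd.{u, max u v} K (MonoidAlgebra K G)) :=
  Module.Basis.mk (linearIndependent_betaCls g hg hN) (span_betaCls g hg hN)

theorem betaBasis_apply (r : ℕ) (x : G) : betaBasis g hg hN (r, x) = betaCls g hg hN r x := by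
  rw [betaBasis, Module.Basis.mk_apply]

end Beta

/-! ### Derivations as classes of degree one -/

section DerClass

variable {K A : Type*} [CommRing K] [CommRing A] [Algebra K A]

theorem coe_derClass (D : Derivation K A A) (f : Cocycle K A (2 * 0 + 1))
    (h : MultilinearMap.ofSubsingleton K A A (0 : Fin 1) D.toLinearMap = (f : Coch K A (2 * 0 + 1))) :
    (derClass D : HHodd K A) = cls 0 f :=
  congrArg (cls 0) (Subtype.ext h)

/-- On derivations, the Gerstenhaber bracket is the commutator. -/
theorem lie_derClass (D D' : Derivation K A A) : ⁅derClass D, derClass D'⁆ = derClass ⁅D, D'⁆ := by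
  apply Subtype.ext
  refine (lie_cls 0 0 ⟨_, LinearMap.mem_ker.2 (d_derivation D)⟩
    ⟨_, LinearMap.mem_ker.2 (d_derivation D')⟩).trans (coe_derClass ⁅D, D'⁆ _ ?_).symm
  refine Coch.ext_ev fun x => ?_
  change ⁅D, D'⁆ (x 0) = (gerst (odd_add 0 0) _ _ : Coch K A (2 * (0 + 0) + 1)).ev x
  rw [gerst_odd _ (by omega), ev_sub, ev_circ, ev_circ, Derivation.commutator_apply]
  simp [Coch.ev, ins, shift]

end DerClass

/-! ### The derivations given by `β ^ 1 ⊗ x` -/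

section BetaDerivation

universe u v

variable {K : Type u} {G : Type v} [Field K] [CommGroup G] [Fintype G]
variable (g : G) (hg : ∀ x : G, x ∈ Subgroup.zpowers g) (hN : (Fintype.card G : K) = 0)

/-- The derivation `u ↦ i u x` for `u = g ^ i`. -/
def betaDer (x : G) : Derivation.{u, max u v, max u v} K (MonoidAlgebra K G) (MonoidAlgebra K G) :=
  Derivation.mk' ((MultilinearMap.ofSubsingleton K (MonoidAlgebra K G) (MonoidAlgebra K G)
      (0 : Fin 1)).symm (psi (beta K g (2 * 0 + 1)) x)) fun a b => by
    -- The cocycle condition at `(a, b)` is the Leibniz rule.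
    have h : d (2 * 0 + 1) (psi (beta K g (2 * 0 + 1)) x) ![a, b] = 0 := by
      rw [LinearMap.mem_ker.1 (psi_beta_mem g hg hN 0 x)]
      rfl
    change _ * psi (beta K g (2 * 0 + 1)) x _ + ∑ i : Fin 1, (-1 : ℤ) ^ ((i : ℕ) + 1) •
      psi (beta K g (2 * 0 + 1)) x _ + (-1 : ℤ) ^ 2 • (psi (beta K g (2 * 0 + 1)) x _ * _) = 0 at h
    change psi (beta K g (2 * 0 + 1)) x (fun _ => a * b) =
      a * psi (beta K g (2 * 0 + 1)) x (fun _ => b) + b * psi (beta K g (2 * 0 + 1)) x (fun _ => a)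
    have e1 : Fin.tail ![a, b] = fun _ => b := by
      funext i; fin_cases i; rfl
    have e2 : Fin.init ![a, b] = fun _ => a := by
      funext i; fin_cases i; rfl
    have e3 : Fin.contractNth (Fin.castSucc (0 : Fin 1)) (· * ·) ![a, b] = fun _ => a * b := by
      funext i; fin_cases i; rfl
    rw [Fin.sum_univ_one, e1, e2, e3] at h
    simp only [Fin.val_zero, zero_add, pow_one, neg_smul, one_smul, even_two, Even.neg_pow,
      one_pow] at h
    change a * _ + -_ + _ * b = 0 at h
    linear_combination -h

theorem betaDer_single (x w : G) : betaDer g hg hN x (MonoidAlgebra.single w 1) =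
    (expo g w : K) • MonoidAlgebra.single (w * x) 1 := by
  have h := psi_single (beta K g (2 * 0 + 1)) x fun _ => w
  change psi (beta K g (2 * 0 + 1)) x (fun _ => MonoidAlgebra.single w 1) = _
  rw [h]
  have hb := beta_seq K g 0 fun _ => w
  rw [hb]
  simp [betaSeq]

theorem betaDer_gen (x : G) : betaDer g hg hN x (MonoidAlgebra.single g (1 : K)) =
    MonoidAlgebra.single (g * x) 1 := by
  rw [betaDer_single, expo_self_cast g hg hN, one_smul]

theorem derivation_ext_single {D D' : Derivation.{u, max u v, max u v} K (MonoidAlgebra K G) (MonoidAlgebra K G)}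
    (h : ∀ w : G, D (MonoidAlgebra.single w 1) = D' (MonoidAlgebra.single w 1)) : D = D' := by
  have : D.toLinearMap = D'.toLinearMap :=
    (MonoidAlgebra.basis G K).ext fun w => by simpa using h w
  exact Derivation.ext fun a => LinearMap.congr_fun this a

theorem lie_betaDer (x z : G) : ⁅betaDer g hg hN x, betaDer g hg hN z⁆ =
    ((expo g z : K) - expo g x) • betaDer g hg hN (x * z) := by
  refine derivation_ext_single fun w => ?_
  rw [Derivation.commutator_apply, Derivation.smul_apply]
  simp only [betaDer_single, Derivation.map_smul, expo_mul_cast g hg hN]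
  rw [mul_assoc, mul_assoc, mul_comm z x]
  module

/-- The class of degree `1` of `β ^ 1 ⊗ x`. -/
def betaHH1 (x : G) : HH1.{u, max u v} K (MonoidAlgebra K G) :=
  ⟨betaCls g hg hN 0 x, ⟨betaCocycle g hg hN 0 x, rfl⟩⟩

theorem derClass_betaDer (x : G) : derClass (betaDer g hg hN x) = betaHH1 g hg hN x :=
  Subtype.ext <| coe_derClass _ (betaCocycle g hg hN 0 x) (Equiv.apply_symm_apply _ _)

theorem linearIndependent_betaHH1 : LinearIndependent K fun x : G => betaHH1 g hg hN x := by
  have h : LinearIndependent K fun x : G => betaCls g hg hN 0 x :=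
    (linearIndependent_betaCls g hg hN).comp (fun x => (0, x)) fun x y h => congrArg Prod.snd h
  rw [linearIndependent_iff'] at h ⊢
  intro s c hc
  refine h s c ?_
  have hc' := congrArg Subtype.val hc
  rw [AddSubmonoidClass.coe_finsetSum] at hc'
  exact hc'

theorem span_betaHH1 : ⊤ ≤ Submodule.span K (Set.range fun x : G => betaHH1 g hg hN x) := by
  rintro ⟨_, ⟨f, rfl⟩⟩ -
  have h : (⟨cls 0 f, ⟨f, rfl⟩⟩ : HH1.{u, max u v} K (MonoidAlgebra K G)) =
      ∑ x : G, phi g 0 (comp (2 * 0 + 1) x (f : Coch.{u, max u v} K (MonoidAlgebra K G) (2 * 0 + 1)))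
        • betaHH1 g hg hN x := by
    apply Subtype.ext
    refine (cls_eq_sum g hg hN 0 f).trans ?_
    rw [AddSubmonoidClass.coe_finsetSum]
    rfl
  change (⟨cls 0 f, ⟨f, rfl⟩⟩ : HH1.{u, max u v} K (MonoidAlgebra K G)) ∈ _
  rw [h]
  exact Submodule.sum_mem _ fun x _ => Submodule.smul_mem _ _ (Submodule.subset_span ⟨x, rfl⟩)

theorem lie_betaHH1 (x z : G) : ⁅betaHH1 g hg hN x, betaHH1 g hg hN z⁆ =
    ((expo g z : K) - expo g x) • betaHH1 g hg hN (x * z) :=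
  Subtype.ext (lie_betaCls g hg hN 0 0 x z)

/-- The classes of `β ^ 1 ⊗ x` form a basis of `HH ^ 1 (K G)`. -/
def betaHH1Basis : Module.Basis G K (HH1.{u, max u v} K (MonoidAlgebra K G)) :=
  Module.Basis.mk (linearIndependent_betaHH1 g hg hN) (span_betaHH1 g hg hN)

theorem betaHH1Basis_apply (x : G) : betaHH1Basis g hg hN x = betaHH1 g hg hN x := by
  rw [betaHH1Basis, Module.Basis.mk_apply]

end BetaDerivation

/-- A linear map that respects the bracket on a basis respects it everywhere. -/
theorem map_lie_of_basis {ι K L M : Type*} [CommRing K] [LieRing L] [LieAlgebra K L] [LieRing M]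
    [LieAlgebra K M] (b : Module.Basis ι K L) (f : L →ₗ[K] M)
    (h : ∀ i j, f ⁅b i, b j⁆ = ⁅f (b i), f (b j)⁆) (x y : L) : f ⁅x, y⁆ = ⁅f x, f y⁆ := by
  have : LinearMap.mk₂ K (fun x y : L => f ⁅x, y⁆) (by simp) (by simp) (by simp) (by simp) =
      LinearMap.mk₂ K (fun x y : L => ⁅f x, f y⁆) (by simp) (by simp) (by simp) (by simp) :=
    b.ext fun i => b.ext fun j => h i j
  exact LinearMap.congr_fun (LinearMap.congr_fun this x) y

/-- The current algebra is the extension of scalars from `K` to `K[X]`, which is why the polynomial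
factor stands on the left. -/
theorem tmul_lie_tmul {K L : Type*} [CommRing K] [LieRing L] [LieAlgebra K L] (r s : ℕ) (x y : L) :
    ⁅(Polynomial.X ^ r : K[X]) ⊗ₜ[K] x, (Polynomial.X ^ s : K[X]) ⊗ₜ[K] y⁆ =
      (Polynomial.X ^ (r + s) : K[X]) ⊗ₜ[K] ⁅x, y⁆ := by
  rw [LieAlgebra.ExtendScalars.bracket_tmul, pow_add]

/-! ### The isomorphism with the current algebra -/

section Main

universe u v

variable {K : Type u} {G : Type v} [Field K] [CommGroup G] [Fintype G]
variable (g : G) (hg : ∀ x : G, x ∈ Subgroup.zpowers g) (hN : (Fintype.card G : K) = 0)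

/-- The linear equivalence that sends the class of `β ^ (2 r + 1) ⊗ x` to the tensor product of
`t ^ r` and the class of `β ^ 1 ⊗ x`. -/
def currentLinearEquiv : HHodd.{u, max u v} K (MonoidAlgebra K G) ≃ₗ[K]
    K[X] ⊗[K] HH1.{u, max u v} K (MonoidAlgebra K G) :=
  (betaBasis g hg hN).equiv ((Polynomial.basisMonomials K).tensorProduct (betaHH1Basis g hg hN))
    (Equiv.refl _)

theorem currentLinearEquiv_betaCls (r : ℕ) (x : G) :
    currentLinearEquiv g hg hN (betaCls g hg hN r x) =
      (Polynomial.X ^ r : K[X]) ⊗ₜ[K] betaHH1 g hg hN x := by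
  rw [currentLinearEquiv, ← betaBasis_apply, Module.Basis.equiv_apply, Equiv.refl_apply,
    Module.Basis.tensorProduct_apply, betaHH1Basis_apply, Polynomial.coe_basisMonomials]
  exact congrArg (· ⊗ₜ[K] _) (Polynomial.monomial_one_right_eq_X_pow r)

/-- `HH ^ odd (K G)` is the current Lie algebra of `HH ^ 1 (K G)`. -/
def currentLieEquiv : HHodd.{u, max u v} K (MonoidAlgebra K G) ≃ₗ⁅K⁆
    K[X] ⊗[K] HH1.{u, max u v} K (MonoidAlgebra K G) :=
  { currentLinearEquiv g hg hN with
    map_lie' := by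
      intro a b
      refine map_lie_of_basis (betaBasis g hg hN) (currentLinearEquiv g hg hN).toLinearMap ?_ a b
      rintro ⟨r, x⟩ ⟨s, z⟩
      rw [betaBasis_apply, betaBasis_apply, lie_betaCls]
      simp only [LinearEquiv.coe_coe, map_smul]
      rw [currentLinearEquiv_betaCls, currentLinearEquiv_betaCls, currentLinearEquiv_betaCls,
        tmul_lie_tmul, lie_betaHH1, TensorProduct.tmul_smul] }

theorem currentLieEquiv_betaCls (r : ℕ) (x : G) :
    currentLieEquiv g hg hN (betaCls g hg hN r x) =
      (Polynomial.X ^ r : K[X]) ⊗ₜ[K] derClass (betaDer g hg hN x) :=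
  (currentLinearEquiv_betaCls g hg hN r x).trans (by rw [derClass_betaDer])

theorem span_derClass_betaDer :
    Submodule.span K (Set.range fun i : ℕ => derClass (betaDer g hg hN (g ^ i))) = ⊤ := by
  refine top_le_iff.1 ((span_betaHH1 g hg hN).trans (Submodule.span_mono ?_))
  rintro _ ⟨x, rfl⟩
  exact ⟨expo g x, by simp only [pow_expo g hg, derClass_betaDer]⟩

theorem lie_betaDer_pow (i j : ℕ) : ⁅betaDer g hg hN (g ^ i), betaDer g hg hN (g ^ j)⁆ =
    ((j : K) - (i : K)) • betaDer g hg hN (g ^ (i + j)) := by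
  rw [lie_betaDer, expo_pow_cast g hg hN, expo_pow_cast g hg hN, ← pow_add]

end Main

end Hochschild

end

theorem mainTheorem6 {K G : Type*} [Field K] [CommGroup G] [Fintype G]
    (p : ℕ) [Fact p.Prime] (hp : p ≠ 2) [CharP K p] (hG : p ∣ Fintype.card G)
    (g : G) (hg : ∀ x : G, x ∈ Subgroup.zpowers g) :
    ∃ (D : ℕ → Derivation K (MonoidAlgebra K G) (MonoidAlgebra K G))
      (hβ : ∀ r i : ℕ, Hochschild.psi (Hochschild.beta K g (2 * r + 1)) (g ^ i) ∈
        Hochschild.Cocycle K (MonoidAlgebra K G) (2 * r + 1))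
      (e : Hochschild.HHodd K (MonoidAlgebra K G) ≃ₗ⁅K⁆
        K[X] ⊗[K] Hochschild.HH1 K (MonoidAlgebra K G)),
      (∀ i : ℕ, D i (MonoidAlgebra.single g 1) = MonoidAlgebra.single (g ^ (i + 1)) 1) ∧
      (∀ i j : ℕ, ⁅D i, D j⁆ = ((j : K) - (i : K)) • D (i + j)) ∧
      Submodule.span K (Set.range fun i => Hochschild.derClass (D i)) = ⊤ ∧
      (∀ i j r s : ℕ,
        ⁅(Polynomial.X ^ r : K[X]) ⊗ₜ[K] Hochschild.derClass (D i),
          (Polynomial.X ^ s : K[X]) ⊗ₜ[K] Hochschild.derClass (D j)⁆ =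
        (Polynomial.X ^ (r + s) : K[X]) ⊗ₜ[K] Hochschild.derClass ⁅D i, D j⁆) ∧
      ∀ r i : ℕ,
        e (Hochschild.cls r
          ⟨Hochschild.psi (Hochschild.beta K g (2 * r + 1)) (g ^ i), hβ r i⟩) =
        (Polynomial.X ^ r : K[X]) ⊗ₜ[K] Hochschild.derClass (D i) := by
  -- Divisibility of `|G|` by the characteristic enters only in this form: exponents modulo `|G|`
  -- have well-defined values in `K`. In particular `D i` may be indexed by every natural `i`, with
  -- `i` itself as the value of `expo` at `g ^ i`.
  have hN : (Fintype.card G : K) = 0 := (CharP.cast_eq_zero_iff K p _).2 hG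
  refine ⟨fun i => Hochschild.betaDer g hg hN (g ^ i),
    fun r i => Hochschild.psi_beta_mem g hg hN r (g ^ i), Hochschild.currentLieEquiv g hg hN,
    fun i => ?_, Hochschild.lie_betaDer_pow g hg hN, Hochschild.span_derClass_betaDer g hg hN,
    fun i j r s => ?_, fun r i => Hochschild.currentLieEquiv_betaCls g hg hN r (g ^ i)⟩
  · exact (Hochschild.betaDer_gen g hg hN _).trans (by rw [pow_succ'])
  · exact (Hochschild.tmul_lie_tmul r s _ _).trans (by rw [Hochschild.lie_derClass])
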